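/- Let $\mathcal H$ be a real Hilbert space, $n\ge 2$ and $m\ge 0$ integers; $\mathcal H^p$ carries the product Hilbert structure. Let $F_1,\dots,F_n:\mathcal H\rightrightarrows\mathcal H$ be maximally monotone and let $B_i:\mathcal H\to\mathcal H$ be $\frac1{L_i}$-cocoercive with $L_i>0$, i.e. $\langle B_ix-B_iy,x-y\rangle\ge\frac1{L_i}\|B_ix-B_iy\|^2$, $i=1,\dots,m$, and suppose that $\operatorname{zer}\big(\sum_{i=1}^nF_i+\sum_{i=1}^mB_i\big)\ne\emptyset$. For an operator $A$ write $J_A=(\mathrm{Id}+A)^{-1}$. Put $L=\operatorname{diag}(\frac1{L_1},\dots,\frac1{L_m})$, $e_p=(1,\dots,1)^\top\in\mathbb R^p$ and $\|\mathbf u\|_{\mathbf L^{-1}}^2=\sum_{j=1}^mL_j\|u_j\|^2$. Parameters. Let $\varepsilon>0$, $\theta>0$ and let $\gamma_k,\xi_k$ $(k\ge0)$ be real numbers with $\varepsilon\le\gamma_k\le1-\varepsilon$ and $0\le\xi_k\le1-\varepsilon$. Matrices. Let $M\in\mathbb R^{n\times(n-1)}$, $S\in\mathbb R^{n\times n}$,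 $C\in\mathbb R^{n\times m}$, $Q\in\mathbb R^{m\times n}$ satisfy: (a) $\ker M^\top\subseteq\mathbb Re_n$; (b) $C^\top e_n=Qe_n=e_m$, and $C,Q^\top$ are causal: there are integers $0=A_1\le A_2\le\dots\le A_n=m$ such that $C_{ij}=0$ whenever $j>A_i$ and $Q_{ji}=0$ whenever $j\le A_i$; (c) $S$ is symmetric, $e_n^\top Se_n=0$, and $S-MM^\top-\frac12(1+\frac1\theta)(C^\top-Q)^\top L^{-1}(C^\top-Q)$ is positive semidefinite. Then every $S_{ii}$ is positive; put $d_i=2/S_{ii}$. Algorithm. Let $\mathbf z^0\in\mathcal H^{n-1}$ be arbitrary, $\mathbf u^0=0\in\mathcal H^m$, $\mathbf v^0=0\in\mathcal H^{n-1}$, and for all $k\ge0$ let $$x_i^k=J_{d_iF_i}\Big(-d_i\sum_{j=1}^{i-1}S_{ij}x_j^k+d_i\sum_{j=1}^{n-1}M_{ij}(z_j^k+v_j^k)-d_i\sum_{j=1}^mC_{ij}B_j\Big(\sum_{h=1}^{i-1}Q_{jh}x_h^k+u_j^k\Big)\Big),\quad i=1,\dots,n,$$ $$z_i^{k+1}=z_i^k-\gamma_k\sum_{j=1}^nM_{ji}x_j^k,\quad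 i=1,\dots,n-1,$$ where the deviations $\mathbf u^{k+1}\in\mathcal H^m$, $\mathbf v^{k+1}\in\mathcal H^{n-1}$ are any vectors satisfying $$\frac{\gamma_{k+1}}{1-\gamma_{k+1}}\|\mathbf v^{k+1}\|^2+\frac{\gamma_{k+1}(1+\theta)}2\|\mathbf u^{k+1}\|_{\mathbf L^{-1}}^2\le\xi_kl_k^2,\qquad l_k^2=\frac{1-\gamma_k}{\gamma_k}\Big\|\mathbf z^{k+1}-\mathbf z^k+\frac{\gamma_k}{1-\gamma_k}\mathbf v^k\Big\|^2 .$$ Operator. Let $\gamma>0$, $D=\operatorname{diag}(d_1,\dots,d_n)$, let $N$ be minus the strictly lower triangular part of $S$, write $\mathbf P=P\otimes\mathrm{Id}$ for a real matrix $P$, $\mathbf F(\mathbf x)=F_1(x_1)\times\dots\times F_n(x_n)$, $\mathbf B(\mathbf y)=(B_1y_1,\dots,B_my_m)$, and define $T$ on $\mathcal H^{n-1}$ by $$T(\mathbf z)=\mathbf z-\gamma\mathbf M^*\mathbf x,\qquad\mathbf x=J_{\mathbf{DF}}\big(\mathbf{DN}\mathbf x+\mathbf{DM}\mathbf z-\mathbf{DC}\,\mathbf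 B(\mathbf{Qx})\big).$$ Then: (i) $\sum_kl_k^2<\infty$, $\mathbf u^k\to0$ and $\mathbf v^k\to0$; (ii) for every $\mathbf z\in\operatorname{Fix}T$ the sequence $\|\mathbf z^k-\mathbf z\|$ converges; (iii) $\mathbf z^{k+1}-\mathbf z^k\to0$, and $\sum_{i=1}^ns_ix_i^k\to0$ for every $s\in\mathbb R^n$ with $\sum_{i=1}^ns_i=0$; (iv) $\mathbf z^k$ converges weakly to a point of $\operatorname{Fix}T$; (v) $\mathbf x^k=(x_1^k,\dots,x_n^k)$ converges weakly to $(\bar x,\dots,\bar x)$ for some $\bar x\in\operatorname{zer}\big(\sum_{i=1}^nF_i+\sum_{i=1}^mB_i\big)$. -/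

import Mathlib

open Filter Topology
open scoped Pointwise Matrix

noncomputable section

namespace DeviationFBS

/-! ### Set-valued operators -/

section Operators

variable {E : Type*} [NormedAddCommGroup E] [InnerProductSpace ℝ E]

/-- A set-valued operator `A : E ⇉ E` is maximally monotone: `(x, u)` belongs to its graph
if and only if `⟪u - v, x - y⟫ ≥ 0` for every `(y, v)` in the graph. -/
def MaximallyMonotone (A : E → Set E) : Prop :=
  ∀ x u : E, u ∈ A x ↔ ∀ y v : E, v ∈ A y → 0 ≤ inner ℝ (u - v) (x - y)

/-- A single-valued operator is `c`-cocoercive. -/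
def Cocoercive (c : ℝ) (B : E → E) : Prop :=
  ∀ x y : E, c * ‖B x - B y‖ ^ 2 ≤ inner ℝ (B x - B y) (x - y)

/-- A single-valued operator seen as a set-valued one. -/
def singleValued (B : E → E) : E → Set E := fun x => {B x}

/-- The zeros of a set-valued operator. -/
def zer (A : E → Set E) : Set E := {x | 0 ∈ A x}

/-- The resolvent `J_A = (Id + A)⁻¹` as a set-valued operator: `x ∈ J_A y` if and only if
`y ∈ x + A x`. For a maximally monotone `A` it is single-valued with full domain, and
`x ∈ resolvent A y` reads `x = J_A y`. -/
def resolvent (A : E → Set E) : E → Set E := fun y => {x | y ∈ ({x} : Set E) + A x}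

/-- Weak convergence of a sequence. -/
def WeaklyConverges (x : ℕ → E) (a : E) : Prop :=
  Tendsto (fun k => toWeakSpace ℝ E (x k)) atTop (𝓝 (toWeakSpace ℝ E a))

end Operators

/-! ### Product spaces and Kronecker operators -/

/-- The Hilbert product space `H ^ p`. -/
abbrev HilbertPow (H : Type*) (p : ℕ) : Type _ := PiLp 2 (fun _ : Fin p => H)

section ProductSpace

variable {H : Type*} [NormedAddCommGroup H] [InnerProductSpace ℝ H]

/-- The operator `P ⊗ Id : H ^ q → H ^ p` of a `p × q` matrix `P`. Its adjoint is `kron Pᵀ`. -/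
def kron {p q : ℕ} (P : Matrix (Fin p) (Fin q) ℝ) (x : HilbertPow H q) : HilbertPow H p :=
  WithLp.toLp 2 fun i => ∑ j, P i j • x j

/-- The set-valued operator `(x₁, …, x_p) ↦ F₁ x₁ × ⋯ × F_p x_p`. -/
def prodSet {p : ℕ} (F : Fin p → H → Set H) : HilbertPow H p → Set (HilbertPow H p) :=
  fun x => {f | ∀ i, f i ∈ F i (x i)}

/-- The operator `(y₁, …, y_p) ↦ (B₁ y₁, …, B_p y_p)`. -/
def prodMap {p : ℕ} (B : Fin p → H → H) (y : HilbertPow H p) : HilbertPow H p :=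
  WithLp.toLp 2 fun j => B j (y j)

/-- The squared norm `‖u‖²_W = ⟪u, (W ⊗ Id) u⟫` on `H ^ p`. -/
def weightedNormSq {p : ℕ} (W : Matrix (Fin p) (Fin p) ℝ) (u : HilbertPow H p) : ℝ :=
  inner ℝ u (kron W u)

end ProductSpace

/-! ### Matrices and parameters -/

/-- The pair `C, Qᵀ` of `n × m` matrices is causal: there is a nondecreasing vector
`A ∈ {0, …, m}ⁿ` with first entry `0` and last entry `m` such that (with 1-based column
indices `j`) `C i j = 0` for `j > A i` and `Qᵀ i j = 0` for `j ≤ A i`. The column with the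
0-based index `j : Fin m` is column number `j + 1`. -/
def Causal {n m : ℕ} (C : Matrix (Fin n) (Fin m) ℝ) (Q : Matrix (Fin m) (Fin n) ℝ) : Prop :=
  ∃ A : Fin n → Fin (m + 1), Monotone A ∧
    (∀ i : Fin n, (i : ℕ) = 0 → A i = 0) ∧
    (∀ i : Fin n, (i : ℕ) + 1 = n → A i = Fin.last m) ∧
    (∀ (i : Fin n) (j : Fin m), (A i : ℕ) < (j : ℕ) + 1 → C i j = 0) ∧
    (∀ (i : Fin n) (j : Fin m), (j : ℕ) + 1 ≤ (A i : ℕ) → Qᵀ i j = 0)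

/-- The diagonal matrix `L⁻¹ = diag(L₁, …, L_m)`, the inverse of `diag(1/L₁, …, 1/L_m)`. -/
def Linv {m : ℕ} (Lc : Fin m → ℝ) : Matrix (Fin m) (Fin m) ℝ := Matrix.diagonal Lc

/-- The conditions on the scalar parameters. -/
structure ParameterAssumption (ε θ : ℝ) (γ ξ : ℕ → ℝ) : Prop where
  eps_pos : 0 < ε
  theta_pos : 0 < θ
  gamma_mem : ∀ k, ε ≤ γ k ∧ γ k ≤ 1 - ε
  xi_mem : ∀ k, 0 ≤ ξ k ∧ ξ k ≤ 1 - ε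

/-- The conditions on the matrices `M, S, C, Q`. -/
structure MatrixAssumption {n m : ℕ} (θ : ℝ) (Lc : Fin m → ℝ)
    (M : Matrix (Fin n) (Fin (n - 1)) ℝ) (S : Matrix (Fin n) (Fin n) ℝ)
    (C : Matrix (Fin n) (Fin m) ℝ) (Q : Matrix (Fin m) (Fin n) ℝ) : Prop where
  ker_le : LinearMap.ker (Mᵀ).mulVecLin ≤ Submodule.span ℝ {(fun _ => 1 : Fin n → ℝ)}
  causal : Causal C Q
  C_ones : Cᵀ *ᵥ (fun _ => 1) = fun _ => 1
  Q_ones : Q *ᵥ (fun _ => 1) = fun _ => 1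
  S_symm : S.IsSymm
  S_ones : (fun _ => 1) ⬝ᵥ (S *ᵥ (fun _ => 1)) = 0
  S_ge : (S - M * Mᵀ -
    ((1 / 2 : ℝ) * (1 + 1 / θ)) • ((Cᵀ - Q)ᵀ * Linv Lc * (Cᵀ - Q))).PosSemidef

/-- The step sizes `(d₁, …, d_n)`, where `d_i = 2 / S_ii`. -/
def stepSize {n : ℕ} (S : Matrix (Fin n) (Fin n) ℝ) (i : Fin n) : ℝ := 2 * (S i i)⁻¹

/-- The matrix `N`, minus the strictly lower triangular part of `S`. -/
def negLower {n : ℕ} (S : Matrix (Fin n) (Fin n) ℝ) : Matrix (Fin n) (Fin n) ℝ :=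
  Matrix.of fun i j => if j < i then -S i j else 0

/-! ### The operator `T` and the algorithm -/

section Algorithm

variable {H : Type*} [NormedAddCommGroup H] [InnerProductSpace ℝ H] {n m : ℕ}

/-- The operator `T z = z - γ M* x` on `H ^ (n-1)`, where `x = J_{DF}(DN x + DM z - DCB(Q x))`.
It is written as a set-valued operator, in the same way as the resolvent through which it is
defined. -/
def opT (F : Fin n → H → Set H) (B : Fin m → H → H)
    (M : Matrix (Fin n) (Fin (n - 1)) ℝ) (S : Matrix (Fin n) (Fin n) ℝ)
    (C : Matrix (Fin n) (Fin m) ℝ) (Q : Matrix (Fin m) (Fin n) ℝ) (γ : ℝ)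
    (z : HilbertPow H (n - 1)) : Set (HilbertPow H (n - 1)) :=
  let D : Matrix (Fin n) (Fin n) ℝ := Matrix.diagonal (stepSize S)
  {w | ∃ x : HilbertPow H n,
    x ∈ resolvent (prodSet fun i => stepSize S i • F i)
      (kron (D * negLower S) x + kron (D * M) z - kron (D * C) (prodMap B (kron Q x))) ∧
    w = z - γ • kron Mᵀ x}

/-- The fixed points of a (set-valued) operator. -/
def fixedPts {X : Type*} (T : X → Set X) : Set X := {z | z ∈ T z}

/-- The quantity `l_k² = (1 - γ_k) / γ_k * ‖z^{k+1} - z^k + γ_k / (1 - γ_k) v^k‖²`. -/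
def lSq (γ : ℕ → ℝ) (z v : ℕ → HilbertPow H (n - 1)) (k : ℕ) : ℝ :=
  (1 - γ k) / γ k * ‖z (k + 1) - z k + (γ k / (1 - γ k)) • v k‖ ^ 2

/-- `x, z` are generated by the frugal forward-backward method with the deviations `u, v`. -/
structure IsGenerated (F : Fin n → H → Set H) (B : Fin m → H → H) (Lc : Fin m → ℝ)
    (M : Matrix (Fin n) (Fin (n - 1)) ℝ) (S : Matrix (Fin n) (Fin n) ℝ)
    (C : Matrix (Fin n) (Fin m) ℝ) (Q : Matrix (Fin m) (Fin n) ℝ)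
    (θ : ℝ) (γ ξ : ℕ → ℝ)
    (x : ℕ → HilbertPow H n) (z : ℕ → HilbertPow H (n - 1))
    (u : ℕ → HilbertPow H m) (v : ℕ → HilbertPow H (n - 1)) : Prop where
  u_zero : u 0 = 0
  v_zero : v 0 = 0
  x_step : ∀ (k : ℕ) (i : Fin n),
    x k i ∈ resolvent (stepSize S i • F i)
      (-(stepSize S i • ∑ j ∈ Finset.Iio i, S i j • x k j)
        + stepSize S i • ∑ j : Fin (n - 1), M i j • (z k j + v k j)
        - stepSize S i • ∑ j : Fin m,
            C i j • B j (∑ h ∈ Finset.Iio i, Q j h • x k h + u k j))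
  z_step : ∀ (k : ℕ) (i : Fin (n - 1)),
    z (k + 1) i = z k i - γ k • ∑ j : Fin n, M j i • x k j
  deviation_le : ∀ k : ℕ,
    γ (k + 1) / (1 - γ (k + 1)) * ‖v (k + 1)‖ ^ 2
      + γ (k + 1) * (1 + θ) / 2 * weightedNormSq (Linv Lc) (u (k + 1)) ≤ ξ k * lSq γ z v k

end Algorithm

end DeviationFBS

end

open DeviationFBS

/-!
The resolvent steps of the algorithm say that `(N - D⁻¹) x + M (z + v) - C B(Q x + u)` belongs to
`F x`, and the fixed points `p` of `T` are the vectors for which `x = (a, …, a)`, `z = p`,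
`u = v = 0` satisfies the same inclusion; `a` is then a zero of the sum of the operators. Comparing
the two inclusions, monotonicity of the `F i`, cocoercivity of the `B j` and the positive
semidefinite matrix of the hypotheses bound `‖z (k + 1) - p‖²` by `‖z k - p‖² - l_k²` plus the size
of the deviations at step `k`. As that size is at most `(1 - ε) l_{k-1}²` for `k ≥ 1`, its sum with
`‖z k - p‖²` decreases, which gives the summability and the convergence of the distances.

The sequence `Mᵀ x k = (z k - z (k + 1)) / γ_k` then tends to `0`, hence so do all differences of
components of `x k`, and a weak cluster point of `x k` has the form `(a, …, a)`. The inclusion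
passes to the limit because the duality products of the `F i` and `B j` sum to terms that each
contain a factor tending to `0`. Opial's lemma gives the weak convergence of `z k`. Since `F 0`
receives no forward term, its resolvent determines `a` from `p`, so that `x k` converges weakly
as well.
-/

noncomputable section

namespace DeviationFBS

open Asymptotics

/-! ### Boundedness and weak convergence along filters -/

section WeakConvergence

variable {ι E E' : Type*} [NormedAddCommGroup E] [InnerProductSpace ℝ E]
  [NormedAddCommGroup E'] [InnerProductSpace ℝ E'] {l : Filter ι} {x y : ι → E} {a b : E}

theorem tendsto_inner_zero_of_isBigO_one (hx : x =O[l] fun _ => (1 : ℝ))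
    (hy : Tendsto y l (𝓝 0)) : Tendsto (fun k => inner ℝ (x k) (y k)) l (𝓝 0) := by
  have hxy : (fun k => inner ℝ (x k) (y k)) =O[l] fun k => 1 * ‖y k‖ :=
    (IsBigO.of_norm_le fun k => norm_inner_le_norm (x k) (y k)).trans
      (hx.norm_left.mul (isBigO_refl _ _))
  exact hxy.trans_tendsto (by simpa using hy.norm)

omit [InnerProductSpace ℝ E] in
theorem tendsto_zero_of_mul_norm_sq_le {c : ℝ} (hc : 0 < c) {d : ι → ℝ}
    (hle : ∀ k, c * ‖x k‖ ^ 2 ≤ d k) (hd : Tendsto d l (𝓝 0)) : Tendsto x l (𝓝 0) := by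
  have hsq : Tendsto (fun k => ‖x k‖ ^ 2) l (𝓝 0) :=
    squeeze_zero (fun k => sq_nonneg _)
      (fun k => (le_div_iff₀' hc).mpr (hle k)) (by simpa using hd.div_const c)
  exact tendsto_zero_iff_norm_tendsto_zero.mpr (by simpa using hsq.sqrt)

omit [InnerProductSpace ℝ E] in
theorem isBigO_one_of_tendsto_norm_sub {r : ℝ} (h : Tendsto (fun k => ‖x k - a‖) l (𝓝 r)) :
    x =O[l] fun _ => (1 : ℝ) := by
  simpa using (isBigO_norm_left.mp (h.isBigO_one ℝ)).add
    (isBigO_const_const a (one_ne_zero' ℝ) l)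

/-- Weak convergence along a filter; `WeaklyConverges x` is `TendstoWeakly x atTop`. Ultrafilters
finer than `atTop` stand for weakly convergent subsequences. -/
def TendstoWeakly (x : ι → E) (l : Filter ι) (a : E) : Prop :=
  Tendsto (fun k => toWeakSpace ℝ E (x k)) l (𝓝 (toWeakSpace ℝ E a))

theorem tendstoWeakly_of_tendsto (h : Tendsto x l (𝓝 a)) : TendstoWeakly x l a :=
  ((toWeakSpaceCLM ℝ E).continuous.tendsto a).comp h

namespace TendstoWeakly

theorem mono {l' : Filter ι} (h : TendstoWeakly x l a) (hl : l' ≤ l) : TendstoWeakly x l' a :=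
  Tendsto.mono_left h hl

theorem add (hx : TendstoWeakly x l a) (hy : TendstoWeakly y l b) :
    TendstoWeakly (fun k => x k + y k) l (a + b) := by
  simpa only [TendstoWeakly, map_add] using Tendsto.add hx hy

theorem sub (hx : TendstoWeakly x l a) (hy : TendstoWeakly y l b) :
    TendstoWeakly (fun k => x k - y k) l (a - b) := by
  simpa only [TendstoWeakly, map_sub] using Tendsto.sub hx hy

theorem map (h : TendstoWeakly x l a) (f : E →L[ℝ] E') :
    TendstoWeakly (fun k => f (x k)) l (f a) :=
  ((WeakSpace.map f).continuous.tendsto _).comp h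

theorem inner_right (h : TendstoWeakly x l a) (w : E) :
    Tendsto (fun k => inner ℝ (x k) w) l (𝓝 (inner ℝ a w)) := by
  have heval : Tendsto (fun k => innerSL ℝ w (x k)) l (𝓝 (innerSL ℝ w a)) :=
    ((WeakBilin.eval_continuous (topDualPairing ℝ E).flip (innerSL ℝ w)).tendsto _).comp h
  simpa only [innerSL_apply_apply, real_inner_comm w] using heval

theorem unique [l.NeBot] (ha : TendstoWeakly x l a) (hb : TendstoWeakly x l b) : a = b :=
  ext_inner_right ℝ fun w => tendsto_nhds_unique (ha.inner_right w) (hb.inner_right w)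

end TendstoWeakly

variable [CompleteSpace E]

theorem tendstoWeakly_of_forall_inner
    (h : ∀ w, Tendsto (fun k => inner ℝ (x k) w) l (𝓝 (inner ℝ a w))) : TendstoWeakly x l a := by
  have hinj : Function.Injective (topDualPairing ℝ E).flip := fun v v' hv =>
    ext_inner_left ℝ fun w => LinearMap.congr_fun hv (innerSL ℝ w)
  refine (WeakBilin.tendsto_iff_forall_eval_tendsto _ hinj).mpr fun f => ?_
  have hf := h ((InnerProductSpace.toDual ℝ E).symm f)
  simp only [real_inner_comm ((InnerProductSpace.toDual ℝ E).symm f),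
    InnerProductSpace.toDual_symm_apply] at hf
  exact hf

theorem exists_tendstoWeakly_of_isBigO_one (U : Ultrafilter ι)
    (hx : x =O[(U : Filter ι)] fun _ => (1 : ℝ)) : ∃ a, TendstoWeakly x U a := by
  obtain ⟨r, hr⟩ := hx.bound
  let f : ι → WeakDual ℝ E := fun k => StrongDual.toWeakDual (InnerProductSpace.toDual ℝ E (x k))
  have hf : ∀ᶠ k in (U : Filter ι),
      f k ∈ WeakDual.toStrongDual ⁻¹' Metric.closedBall (0 : StrongDual ℝ E) r := by
    filter_upwards [hr] with k hk
    simpa [f] using! hk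
  obtain ⟨g, -, hg⟩ := (WeakDual.isCompact_closedBall (𝕜 := ℝ) (0 : StrongDual ℝ E) r)
    |>.ultrafilter_le_nhds (U.map f) (le_principal_iff.mpr hf)
  refine ⟨(InnerProductSpace.toDual ℝ E).symm (WeakDual.toStrongDual g),
    tendstoWeakly_of_forall_inner fun w => ?_⟩
  rw [InnerProductSpace.toDual_symm_apply]
  exact ((WeakDual.eval_continuous w).tendsto g).comp hg

/-- Opial's lemma. The inner products `⟪x k, p - q⟫` converge for any two weak cluster points
`p`, `q`, so that `p - q` is orthogonal to itself. -/
theorem exists_mem_tendstoWeakly_of_tendsto_norm_sub [l.NeBot] {Z : Set E} (hZ : Z.Nonempty)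
    (hdist : ∀ p ∈ Z, ∃ r : ℝ, Tendsto (fun k => ‖x k - p‖) l (𝓝 r))
    (hcluster : ∀ (U : Ultrafilter ι) (p : E), (U : Filter ι) ≤ l → TendstoWeakly x U p → p ∈ Z) :
    ∃ p ∈ Z, TendstoWeakly x l p := by
  have hbdd : x =O[l] fun _ => (1 : ℝ) := by
    obtain ⟨p, hp⟩ := hZ
    obtain ⟨r, hr⟩ := hdist p hp
    exact isBigO_one_of_tendsto_norm_sub hr
  have hlim_inner : ∀ p ∈ Z, ∀ q ∈ Z,
      ∃ c : ℝ, Tendsto (fun k => inner ℝ (x k) (p - q)) l (𝓝 c) := by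
    intro p hp q hq
    obtain ⟨a, ha⟩ := hdist p hp
    obtain ⟨b, hb⟩ := hdist q hq
    refine ⟨(b ^ 2 - a ^ 2 - ‖q‖ ^ 2 + ‖p‖ ^ 2) / 2, ?_⟩
    refine (((((hb.pow 2).sub (ha.pow 2)).sub_const (‖q‖ ^ 2)).add_const
      (‖p‖ ^ 2)).div_const 2).congr fun k => ?_
    rw [norm_sub_sq_real, norm_sub_sq_real, inner_sub_right]
    ring
  have hunique : ∀ (U V : Ultrafilter ι) (p q : E), (U : Filter ι) ≤ l → (V : Filter ι) ≤ l →
      TendstoWeakly x U p → TendstoWeakly x V q → p = q := by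
    intro U V p q hU hV hp hq
    obtain ⟨c, hc⟩ := hlim_inner p (hcluster U p hU hp) q (hcluster V q hV hq)
    have hpc := tendsto_nhds_unique (hp.inner_right _) (hc.mono_left hU)
    have hqc := tendsto_nhds_unique (hq.inner_right _) (hc.mono_left hV)
    rw [← sub_eq_zero, ← inner_self_eq_zero (𝕜 := ℝ), inner_sub_left, hpc, hqc, sub_self]
  obtain ⟨U, hU⟩ := Ultrafilter.exists_le l
  obtain ⟨p, hp⟩ := exists_tendstoWeakly_of_isBigO_one U (hbdd.mono hU)
  refine ⟨p, hcluster U p hU hp, (tendsto_iff_ultrafilter _ _ _).mpr fun V hV => ?_⟩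
  obtain ⟨q, hq⟩ := exists_tendstoWeakly_of_isBigO_one V (hbdd.mono hV)
  exact hunique U V p q hU hV hp hq ▸ hq

end WeakConvergence

/-! ### Monotone operators -/

section MonotoneOperators

variable {E : Type*} [NormedAddCommGroup E] [InnerProductSpace ℝ E] {A : E → Set E}

namespace MaximallyMonotone

theorem inner_nonneg (hA : MaximallyMonotone A) {x u y v : E} (hu : u ∈ A x) (hv : v ∈ A y) :
    0 ≤ inner ℝ (u - v) (x - y) :=
  (hA x u).mp hu y v hv

theorem mul_norm_sub_le (hA : MaximallyMonotone A) {s : ℝ} {x y p q : E}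
    (hx : p - s • x ∈ A x) (hy : q - s • y ∈ A y) : s * ‖x - y‖ ≤ ‖p - q‖ := by
  have hmono := hA.inner_nonneg hx hy
  rw [show p - s • x - (q - s • y) = (p - q) - s • (x - y) by module, inner_sub_left,
    real_inner_smul_left, real_inner_self_eq_norm_sq] at hmono
  have hcs := real_inner_le_norm (p - q) (x - y)
  rcases (norm_nonneg (x - y)).eq_or_lt with hxy | hxy
  · simp [← hxy]
  · exact le_of_mul_le_mul_right (by linarith) hxy

theorem exists_inner_nonpos (hA : MaximallyMonotone A) (x u : E) :
    ∃ y v, v ∈ A y ∧ inner ℝ (u - v) (x - y) ≤ 0 ∧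
      (inner ℝ (u - v) (x - y) = 0 → u ∈ A x) := by
  by_cases hu : u ∈ A x
  · exact ⟨x, u, hu, by simp, fun _ => hu⟩
  · have hneg := mt (hA x u).mpr hu
    push Not at hneg
    obtain ⟨y, v, hv, hlt⟩ := hneg
    exact ⟨y, v, hv, hlt.le, fun h => absurd h hlt.ne⟩

end MaximallyMonotone

section Families

variable {ι κ : Type*} [Fintype κ] {A : κ → E → Set E}

theorem mem_of_forall_sum_inner_nonneg (hA : ∀ i, MaximallyMonotone (A i)) {x u : κ → E}
    (h : ∀ y v : κ → E, (∀ i, v i ∈ A i (y i)) → 0 ≤ ∑ i, inner ℝ (u i - v i) (x i - y i))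
    (i : κ) : u i ∈ A i (x i) := by
  choose y v hv hle hmem using fun i => (hA i).exists_inner_nonpos (x i) (u i)
  have hzero := (Finset.sum_eq_zero_iff_of_nonpos fun i _ => hle i).mp
    (le_antisymm (Finset.sum_nonpos fun i _ => hle i) (h y v hv))
  exact hmem i (hzero i (Finset.mem_univ i))

/-- The factors need not be demiclosed one by one: only the sum of the duality products has to
converge. -/
theorem mem_of_tendstoWeakly_of_tendsto_sum_inner {l : Filter ι} [l.NeBot]
    (hA : ∀ i, MaximallyMonotone (A i)) {x u : ι → κ → E} {x' u' : κ → E}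
    (hmem : ∀ k i, u k i ∈ A i (x k i))
    (hx : ∀ i, TendstoWeakly (fun k => x k i) l (x' i))
    (hu : ∀ i, TendstoWeakly (fun k => u k i) l (u' i))
    (hlim : Tendsto (fun k => ∑ i, inner ℝ (u k i) (x k i)) l (𝓝 (∑ i, inner ℝ (u' i) (x' i))))
    (i : κ) : u' i ∈ A i (x' i) := by
  refine mem_of_forall_sum_inner_nonneg hA (fun y v hv => ?_) i
  have hexpand : ∀ w s : κ → E, ∑ i, inner ℝ (w i - v i) (s i - y i) =
      ∑ i, inner ℝ (w i) (s i) - ∑ i, inner ℝ (w i) (y i) -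
        ∑ i, inner ℝ (s i) (v i) + ∑ i, inner ℝ (v i) (y i) := fun w s => by
    simp only [← Finset.sum_sub_distrib, ← Finset.sum_add_distrib, inner_sub_left,
      inner_sub_right, real_inner_comm (v _) (s _)]
    exact Finset.sum_congr rfl fun i _ => by ring
  rw [hexpand]
  have htest := ((hlim.sub (tendsto_finsetSum Finset.univ fun i _ => (hu i).inner_right (y i))).sub
    (tendsto_finsetSum Finset.univ fun i _ => (hx i).inner_right (v i))).add_const
      (∑ i, inner ℝ (v i) (y i))
  refine ge_of_tendsto' htest fun k => ?_
  rw [← hexpand]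
  exact Finset.sum_nonneg fun i _ => (hA i).inner_nonneg (hmem k i) (hv i)

theorem inner_nonneg_of_mem_prodSet {p : ℕ} {A : Fin p → E → Set E}
    (hA : ∀ i, MaximallyMonotone (A i)) {x u y v : HilbertPow E p} (hu : u ∈ prodSet A x)
    (hv : v ∈ prodSet A y) : 0 ≤ inner ℝ (u - v) (x - y) := by
  rw [PiLp.inner_apply]
  exact Finset.sum_nonneg fun i _ => (hA i).inner_nonneg (hu i) (hv i)

end Families

section SingleValued

variable {B : E → E}

theorem maximallyMonotone_singleValued (hcont : Continuous B)
    (hmono : ∀ x y, 0 ≤ inner ℝ (B x - B y) (x - y)) :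
    MaximallyMonotone (singleValued B) := by
  refine fun x u => ⟨?_, fun h => ?_⟩
  · rintro rfl y v rfl
    exact hmono x y
  set w := u - B x with hw
  -- Test `(x, u)` against the points `x + t • w` of the graph and let `t` decrease to `0`.
  have hneg : ∀ᶠ t in 𝓝[>] (0 : ℝ), inner ℝ (u - B (x + t • w)) w ≤ 0 := by
    filter_upwards [self_mem_nhdsWithin] with t ht
    have htest := h (x + t • w) _ rfl
    rw [sub_add_cancel_left, inner_neg_right, real_inner_smul_right] at htest
    exact nonpos_of_mul_nonpos_right (neg_nonneg.mp htest) ht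
  have hlim : Tendsto (fun t : ℝ => inner ℝ (u - B (x + t • w)) w) (𝓝[>] 0)
      (𝓝 (inner ℝ w w)) := by
    have hcont' : Continuous fun t : ℝ => inner ℝ (u - B (x + t • w)) w := by fun_prop
    simpa [hw] using (hcont'.tendsto 0).mono_left nhdsWithin_le_nhds
  have hw0 : w = 0 := (real_inner_self_nonpos).mp (le_of_tendsto hlim hneg)
  exact sub_eq_zero.mp hw0

theorem Cocoercive.lipschitzWith {c : ℝ} (hc : 0 < c) (hB : Cocoercive c B) :
    LipschitzWith c⁻¹.toNNReal B := by
  refine LipschitzWith.of_dist_le' fun x y => ?_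
  rw [dist_eq_norm, dist_eq_norm, le_inv_mul_iff₀ hc]
  have hcs := (hB x y).trans (real_inner_le_norm _ _)
  rcases (norm_nonneg (B x - B y)).eq_or_lt with hBxy | hBxy
  · simp [← hBxy]
  · exact le_of_mul_le_mul_right (by linarith) hBxy

theorem Cocoercive.maximallyMonotone {c : ℝ} (hc : 0 < c) (hB : Cocoercive c B) :
    MaximallyMonotone (singleValued B) :=
  maximallyMonotone_singleValued (hB.lipschitzWith hc).continuous
    fun x y => (mul_nonneg hc.le (sq_nonneg _)).trans (hB x y)

end SingleValued

omit [InnerProductSpace ℝ E] in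
theorem mem_resolvent_iff {x y : E} : x ∈ resolvent A y ↔ y - x ∈ A x := by
  simp only [resolvent, Set.mem_ofPred_eq, Set.singleton_add, Set.image_add_left,
    Set.mem_preimage, neg_add_eq_sub]

omit [InnerProductSpace ℝ E] in
theorem mem_zer_iff {n m : ℕ} {F : Fin n → E → Set E} {B : Fin m → E → E} {a : E} :
    a ∈ zer (∑ i, F i + ∑ j, singleValued (B j)) ↔
      ∃ f : Fin n → E, (∀ i, f i ∈ F i a) ∧ ∑ i, f i + ∑ j, B j a = 0 := by
  simp only [zer, Set.mem_ofPred_eq, Pi.add_apply, Finset.sum_apply, Set.mem_add,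
    Set.mem_fintype_sum, singleValued, Set.mem_singleton_iff]
  constructor
  · rintro ⟨_, ⟨f, hf, rfl⟩, _, ⟨b, hb, rfl⟩, h⟩
    exact ⟨f, hf, by simpa [hb] using h⟩
  · rintro ⟨f, hf, h⟩
    exact ⟨_, ⟨f, hf, rfl⟩, _, ⟨fun j => B j a, fun _ => rfl, rfl⟩, h⟩

end MonotoneOperators

/-! ### Kronecker operators -/

section Kron

variable {H : Type*} [NormedAddCommGroup H] [InnerProductSpace ℝ H] {p q r : ℕ}

@[simp]
theorem kron_apply (P : Matrix (Fin p) (Fin q) ℝ) (x : HilbertPow H q) (i : Fin p) :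
    kron P x i = ∑ j, P i j • x j :=
  rfl

/-- The operator `P ⊗ Id` as a continuous linear map, for linearity and for passing to strong and
weak limits. -/
def kronCLM (P : Matrix (Fin p) (Fin q) ℝ) : HilbertPow H q →L[ℝ] HilbertPow H p where
  toFun := kron P
  map_add' x y := by
    ext i
    simp [smul_add, Finset.sum_add_distrib]
  map_smul' c x := by
    ext i
    simp [Finset.smul_sum, smul_comm c]
  cont := by
    unfold kron
    fun_prop

@[simp]
theorem kronCLM_apply (P : Matrix (Fin p) (Fin q) ℝ) (x : HilbertPow H q) :
    kronCLM P x = kron P x :=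
  rfl

theorem kron_sub (P : Matrix (Fin p) (Fin q) ℝ) (x y : HilbertPow H q) :
    kron P (x - y) = kron P x - kron P y :=
  map_sub (kronCLM P) x y

theorem kron_zero (P : Matrix (Fin p) (Fin q) ℝ) : kron P (0 : HilbertPow H q) = 0 :=
  map_zero (kronCLM P)

theorem add_kron (P P' : Matrix (Fin p) (Fin q) ℝ) (x : HilbertPow H q) :
    kron (P + P') x = kron P x + kron P' x := by
  ext i
  simp [add_smul, Finset.sum_add_distrib]

theorem sub_kron (P P' : Matrix (Fin p) (Fin q) ℝ) (x : HilbertPow H q) :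
    kron (P - P') x = kron P x - kron P' x := by
  ext i
  simp [sub_smul, Finset.sum_sub_distrib]

theorem smul_kron (c : ℝ) (P : Matrix (Fin p) (Fin q) ℝ) (x : HilbertPow H q) :
    kron (c • P) x = c • kron P x := by
  ext i
  simp [Finset.smul_sum, mul_smul]

theorem one_kron (x : HilbertPow H p) : kron (1 : Matrix (Fin p) (Fin p) ℝ) x = x := by
  ext i
  simp [Matrix.one_apply, ite_smul]

theorem mul_kron (P : Matrix (Fin p) (Fin q) ℝ) (P' : Matrix (Fin q) (Fin r) ℝ)
    (x : HilbertPow H r) : kron (P * P') x = kron P (kron P' x) := by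
  ext i
  simp only [kron_apply, Matrix.mul_apply, Finset.sum_smul, Finset.smul_sum, mul_smul]
  exact Finset.sum_comm

theorem inner_kron (P : Matrix (Fin p) (Fin q) ℝ) (x : HilbertPow H q) (y : HilbertPow H p) :
    inner ℝ (kron P x) y = inner ℝ x (kron Pᵀ y) := by
  simp only [PiLp.inner_apply, kron_apply, sum_inner, inner_sum, Matrix.transpose_apply,
    real_inner_smul_left, real_inner_smul_right]
  exact Finset.sum_comm

open scoped MatrixOrder Matrix.Norms.L2Operator in
theorem inner_kron_self_nonneg {P : Matrix (Fin p) (Fin p) ℝ} (hP : P.PosSemidef)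
    (x : HilbertPow H p) : 0 ≤ inner ℝ x (kron P x) := by
  obtain ⟨R, rfl⟩ := CStarAlgebra.nonneg_iff_eq_star_mul_self.mp hP.nonneg
  rw [Matrix.star_eq_conjTranspose, Matrix.conjTranspose_eq_transpose_of_trivial, mul_kron,
    ← inner_kron]
  exact real_inner_self_nonneg

theorem sum_kron {P : Matrix (Fin p) (Fin q) ℝ} {c : ℝ} (hP : Pᵀ *ᵥ (fun _ => 1) = fun _ => c)
    (x : HilbertPow H q) : ∑ i, kron P x i = c • ∑ j, x j := by
  have hcol : ∀ j, ∑ i, P i j = c := fun j => by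
    simpa [Matrix.mulVec, dotProduct] using congrFun hP j
  simp only [kron_apply]
  rw [Finset.sum_comm]
  simp only [← Finset.sum_smul, hcol, Finset.smul_sum]

theorem weightedNormSq_Linv (Lc : Fin p → ℝ) (u : HilbertPow H p) :
    weightedNormSq (Linv Lc) u = ∑ j, Lc j * ‖u j‖ ^ 2 := by
  simp [weightedNormSq, Linv, PiLp.inner_apply, Matrix.diagonal_apply, ite_smul,
    real_inner_smul_right]

/-- The vector `(a, …, a)` of length `p`. For `M` as in `MatrixAssumption`, these are the vectors
annihilated by `Mᵀ ⊗ Id`. -/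
def diagVec {X : Type*} (p : ℕ) (a : X) : HilbertPow X p :=
  WithLp.toLp 2 fun _ => a

@[simp]
theorem diagVec_apply {X : Type*} (a : X) (i : Fin p) : diagVec p a i = a :=
  rfl

theorem kron_diagVec {P : Matrix (Fin p) (Fin q) ℝ} {c : ℝ} (hP : P *ᵥ (fun _ => 1) = fun _ => c)
    (a : H) : kron P (diagVec q a) = c • diagVec p a := by
  ext i
  have hrow : ∑ j, P i j = c := by simpa [Matrix.mulVec, dotProduct] using congrFun hP i
  simp [← Finset.sum_smul, hrow]

theorem isBigO_apply {ι : Type*} {l : Filter ι} (x : ι → HilbertPow H p) (i : Fin p) :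
    (fun k => x k i) =O[l] x :=
  (PiLp.proj 2 (fun _ : Fin p => H) i : HilbertPow H p →L[ℝ] H).isBigO_comp x l

theorem isBigO_of_forall_apply {ι : Type*} {l : Filter ι} {x : ι → HilbertPow H p} {g : ι → ℝ}
    (h : ∀ i, (fun k => x k i) =O[l] g) : x =O[l] g :=
  ContinuousLinearMap.isBigO_comp
    ((PiLp.continuousLinearEquiv 2 ℝ fun _ : Fin p => H).symm : (Fin p → H) →L[ℝ] HilbertPow H p)
    (fun k => (x k).ofLp) l |>.trans (isBigO_pi.mpr h)

end Kron

/-! ### The matrix conditions -/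

section KernelInclusion

variable {H : Type*} [NormedAddCommGroup H] [InnerProductSpace ℝ H] {p q r : ℕ}
  {M : Matrix (Fin p) (Fin q) ℝ}

theorem exists_mulVec_eq_of_sum_eq_zero
    (hM : LinearMap.ker (Mᵀ).mulVecLin ≤ Submodule.span ℝ {(fun _ => 1 : Fin p → ℝ)})
    {s : Fin p → ℝ} (hs : ∑ i, s i = 0) : ∃ t, M *ᵥ t = s := by
  have hker : (⨅ j, LinearMap.ker (LinearMap.proj j ∘ₗ (Mᵀ).mulVecLin)) ≤
      LinearMap.ker (dotProductBilin ℝ ℝ s) := by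
    intro w hw
    have hw' : w ∈ LinearMap.ker (Mᵀ).mulVecLin := by
      ext j
      exact (Submodule.mem_iInf _).mp hw j
    obtain ⟨c, rfl⟩ := Submodule.mem_span_singleton.mp (hM hw')
    simp [dotProduct, hs]
  obtain ⟨t, ht⟩ := Submodule.mem_span_range_iff_exists_fun ℝ |>.mp
    (mem_span_of_iInf_ker_le_ker hker)
  refine ⟨t, funext fun i => ?_⟩
  simpa [Matrix.mulVec, dotProduct, mul_comm, Pi.single_apply] using
    LinearMap.congr_fun ht (Pi.single i 1)

theorem exists_mul_transpose_eq
    (hM : LinearMap.ker (Mᵀ).mulVecLin ≤ Submodule.span ℝ {(fun _ => 1 : Fin p → ℝ)})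
    {P : Matrix (Fin r) (Fin p) ℝ} (hP : P *ᵥ (fun _ => 1) = 0) :
    ∃ R : Matrix (Fin r) (Fin q) ℝ, R * Mᵀ = P := by
  choose R hR using fun i => exists_mulVec_eq_of_sum_eq_zero hM (s := P i) (by
    simpa [Matrix.mulVec, dotProduct] using congrFun hP i)
  refine ⟨Matrix.of R, ?_⟩
  ext i j
  simpa [Matrix.mul_apply, Matrix.mulVec, dotProduct, mul_comm] using congrFun (hR i) j

theorem tendsto_kron_zero_of_tendsto_kron_transpose
    (hM : LinearMap.ker (Mᵀ).mulVecLin ≤ Submodule.span ℝ {(fun _ => 1 : Fin p → ℝ)})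
    {P : Matrix (Fin r) (Fin p) ℝ} (hP : P *ᵥ (fun _ => 1) = 0) {ι : Type*} {l : Filter ι}
    {x : ι → HilbertPow H p} (hx : Tendsto (fun k => kron Mᵀ (x k)) l (𝓝 0)) :
    Tendsto (fun k => kron P (x k)) l (𝓝 0) := by
  obtain ⟨R, rfl⟩ := exists_mul_transpose_eq hM hP
  have hlim := ((kronCLM (H := H) R).continuous.tendsto 0).comp hx
  rw [map_zero] at hlim
  simp only [mul_kron]
  exact hlim

/-- The matrix of `x ↦ (x_i - x_{i₀})_i`. It annihilates the constant vectors, so it factors through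
`Mᵀ` whenever `ker Mᵀ` consists of constant vectors. -/
def subEntry (i₀ : Fin p) : Matrix (Fin p) (Fin p) ℝ :=
  1 - Matrix.of fun _ j => (Pi.single i₀ 1 : Fin p → ℝ) j

theorem subEntry_mulVec_ones (i₀ : Fin p) : subEntry i₀ *ᵥ (fun _ => 1) = 0 := by
  ext i
  simp [subEntry, Matrix.mulVec, dotProduct, Matrix.one_apply]

theorem kron_subEntry (i₀ : Fin p) (x : HilbertPow H p) :
    kron (subEntry i₀) x = x - diagVec p (x i₀) := by
  ext i
  simp [subEntry, sub_kron, one_kron, Pi.single_apply, ite_smul]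

theorem kron_subEntry_transpose (i₀ : Fin p) {x : HilbertPow H p} (hx : ∑ i, x i = 0) :
    kron (subEntry i₀)ᵀ x = x := by
  ext i
  simp [subEntry, Matrix.transpose_sub, sub_kron, one_kron, ← Finset.smul_sum, hx]

theorem tendsto_sub_apply_of_tendsto_kron_transpose
    (hM : LinearMap.ker (Mᵀ).mulVecLin ≤ Submodule.span ℝ {(fun _ => 1 : Fin p → ℝ)})
    {ι : Type*} {l : Filter ι} {x : ι → HilbertPow H p}
    (hx : Tendsto (fun k => kron Mᵀ (x k)) l (𝓝 0)) (i j : Fin p) :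
    Tendsto (fun k => x k i - x k j) l (𝓝 0) := by
  simpa only [Function.comp_def, kron_subEntry, PiLp.sub_apply, diagVec_apply,
    PiLp.zero_apply] using ((PiLp.continuous_apply 2 _ i).tendsto _).comp
      (tendsto_kron_zero_of_tendsto_kron_transpose hM (subEntry_mulVec_ones j) hx)

theorem tendsto_sum_smul_of_tendsto_kron_transpose
    (hM : LinearMap.ker (Mᵀ).mulVecLin ≤ Submodule.span ℝ {(fun _ => 1 : Fin p → ℝ)})
    {s : Fin p → ℝ} (hs : ∑ i, s i = 0) {ι : Type*} {l : Filter ι} {x : ι → HilbertPow H p}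
    (hx : Tendsto (fun k => kron Mᵀ (x k)) l (𝓝 0)) :
    Tendsto (fun k => ∑ i, s i • x k i) l (𝓝 0) := by
  have hrow : Matrix.of (fun _ : Fin 1 => s) *ᵥ (fun _ => 1) = 0 := by
    ext
    simpa [Matrix.mulVec, dotProduct] using hs
  exact ((PiLp.continuous_apply 2 _ 0).tendsto _).comp
    (tendsto_kron_zero_of_tendsto_kron_transpose hM hrow hx)

theorem exists_eq_diagVec_of_kron_transpose_eq_zero [NeZero p]
    (hM : LinearMap.ker (Mᵀ).mulVecLin ≤ Submodule.span ℝ {(fun _ => 1 : Fin p → ℝ)})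
    {x : HilbertPow H p} (hx : kron Mᵀ x = 0) : ∃ a, x = diagVec p a := by
  obtain ⟨R, hR⟩ := exists_mul_transpose_eq hM (subEntry_mulVec_ones 0)
  refine ⟨x 0, sub_eq_zero.mp ?_⟩
  rw [← kron_subEntry, ← hR, mul_kron, hx, kron_zero]

theorem exists_kron_eq_of_sum_eq_zero [NeZero p]
    (hM : LinearMap.ker (Mᵀ).mulVecLin ≤ Submodule.span ℝ {(fun _ => 1 : Fin p → ℝ)})
    {w : HilbertPow H p} (hw : ∑ i, w i = 0) : ∃ y, kron M y = w := by
  obtain ⟨R, hR⟩ := exists_mul_transpose_eq hM (subEntry_mulVec_ones 0)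
  refine ⟨kron Rᵀ w, ?_⟩
  rw [← mul_kron, ← Matrix.transpose_transpose M, ← Matrix.transpose_mul, hR,
    kron_subEntry_transpose 0 hw]

end KernelInclusion

theorem exists_ne_zero_of_ker_transpose_le {n q : ℕ} [Nontrivial (Fin n)]
    {M : Matrix (Fin n) (Fin q) ℝ}
    (hM : LinearMap.ker (Mᵀ).mulVecLin ≤ Submodule.span ℝ {(fun _ => 1 : Fin n → ℝ)})
    (i : Fin n) : ∃ j, M i j ≠ 0 := by
  by_contra! hrow
  have hmem : Pi.single i (1 : ℝ) ∈ LinearMap.ker (Mᵀ).mulVecLin := by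
    ext j
    simp [hrow]
  obtain ⟨c, hc⟩ := Submodule.mem_span_singleton.mp (hM hmem)
  obtain ⟨l, hl⟩ := exists_ne i
  have hci : c = 1 := by simpa using congrFun hc i
  have hcl : c = 0 := by simpa [hl] using congrFun hc l
  exact one_ne_zero (hci.symm.trans hcl)

theorem dotProduct_mul_transpose_mulVec {p q : ℕ} (M : Matrix (Fin p) (Fin q) ℝ)
    (s : Fin p → ℝ) : s ⬝ᵥ ((M * Mᵀ) *ᵥ s) = (Mᵀ *ᵥ s) ⬝ᵥ (Mᵀ *ᵥ s) := by
  rw [← Matrix.mulVec_mulVec, Matrix.dotProduct_mulVec, ← Matrix.mulVec_transpose]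

namespace MatrixAssumption

variable {n m : ℕ} {θ : ℝ} {Lc : Fin m → ℝ} {M : Matrix (Fin n) (Fin (n - 1)) ℝ}
  {S : Matrix (Fin n) (Fin n) ℝ} {C : Matrix (Fin n) (Fin m) ℝ} {Q : Matrix (Fin m) (Fin n) ℝ}

theorem sub_mulVec_ones (h : MatrixAssumption θ Lc M S C Q) : (Cᵀ - Q) *ᵥ (fun _ => 1) = 0 := by
  rw [Matrix.sub_mulVec, h.C_ones, h.Q_ones, sub_self]

theorem M_transpose_mulVec_ones (h : MatrixAssumption θ Lc M S C Q) :
    Mᵀ *ᵥ (fun _ => 1) = 0 := by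
  have hquad := h.S_ge.dotProduct_mulVec_nonneg (fun _ => 1)
  rw [show star (fun _ : Fin n => (1 : ℝ)) = fun _ => 1 from rfl, Matrix.sub_mulVec,
    Matrix.sub_mulVec, Matrix.smul_mulVec, ← Matrix.mulVec_mulVec _ _ (Cᵀ - Q),
    h.sub_mulVec_ones, Matrix.mulVec_zero, smul_zero, sub_zero, dotProduct_sub, h.S_ones,
    dotProduct_mul_transpose_mulVec] at hquad
  have hsq : 0 ≤ (Mᵀ *ᵥ fun _ => 1) ⬝ᵥ (Mᵀ *ᵥ fun _ => 1) :=
    Finset.sum_nonneg fun i _ => mul_self_nonneg _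
  exact dotProduct_self_eq_zero.mp (by linarith)

theorem S_mulVec_ones (h : MatrixAssumption θ Lc M S C Q) : S *ᵥ (fun _ => 1) = 0 := by
  have hdiff : (S - M * Mᵀ - ((1 / 2 : ℝ) * (1 + 1 / θ)) • ((Cᵀ - Q)ᵀ * Linv Lc * (Cᵀ - Q))) *ᵥ
      (fun _ => 1) = S *ᵥ (fun _ => 1) := by
    rw [Matrix.sub_mulVec, Matrix.sub_mulVec, Matrix.smul_mulVec, ← Matrix.mulVec_mulVec,
      ← Matrix.mulVec_mulVec, h.sub_mulVec_ones, h.M_transpose_mulVec_ones]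
    simp
  rw [← hdiff]
  refine (h.S_ge.dotProduct_mulVec_zero_iff _).mp ?_
  rw [hdiff]
  exact h.S_ones

theorem S_diag_pos (h : MatrixAssumption θ Lc M S C Q) (hn : 2 ≤ n) (hθ : 0 < θ)
    (hLc : ∀ j, 0 < Lc j) (i : Fin n) : 0 < S i i := by
  have hgram : (((1 / 2 : ℝ) * (1 + 1 / θ)) •
      ((Cᵀ - Q)ᵀ * Linv Lc * (Cᵀ - Q))).PosSemidef := by
    have hL : (Linv Lc).PosSemidef := Matrix.PosSemidef.diagonal fun j => (hLc j).le
    simpa only [Matrix.conjTranspose_eq_transpose_of_trivial] using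
      (hL.conjTranspose_mul_mul_same (Cᵀ - Q)).smul (by positivity : 0 ≤ (1 / 2) * (1 + 1 / θ))
  have hdiag : (M * Mᵀ) i i ≤ S i i := by
    have hSM : (S - M * Mᵀ).PosSemidef := by simpa using h.S_ge.add hgram
    simpa using hSM.diag_nonneg (i := i)
  have : Nontrivial (Fin n) := Fin.nontrivial_iff_two_le.mpr hn
  obtain ⟨j, hj⟩ := exists_ne_zero_of_ker_transpose_le h.ker_le i
  calc 0 < M i j * M i j := mul_self_pos.mpr hj
    _ ≤ ∑ l, M i l * M i l := Finset.single_le_sum (f := fun l => M i l * M i l)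
        (fun l _ => mul_self_nonneg _) (Finset.mem_univ j)
    _ = (M * Mᵀ) i i := by simp [Matrix.mul_apply]
    _ ≤ S i i := hdiag

theorem le_inner_kron_S {H : Type*} [NormedAddCommGroup H] [InnerProductSpace ℝ H]
    (h : MatrixAssumption θ Lc M S C Q) (w : HilbertPow H n) :
    ‖kron Mᵀ w‖ ^ 2 + (1 / 2) * (1 + 1 / θ) * weightedNormSq (Linv Lc) (kron (Cᵀ - Q) w) ≤
      inner ℝ w (kron S w) := by
  have hnonneg := inner_kron_self_nonneg h.S_ge w
  have hM : inner ℝ w (kron M (kron Mᵀ w)) = ‖kron Mᵀ w‖ ^ 2 := by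
    rw [real_inner_comm, inner_kron, real_inner_self_eq_norm_sq]
  have hCQ : inner ℝ w (kron (Cᵀ - Q)ᵀ (kron (Linv Lc) (kron (Cᵀ - Q) w))) =
      weightedNormSq (Linv Lc) (kron (Cᵀ - Q) w) := by
    rw [weightedNormSq, inner_kron]
  rw [sub_kron, sub_kron, smul_kron, mul_kron, mul_kron, mul_kron, inner_sub_right,
    inner_sub_right, real_inner_smul_right, hM, hCQ] at hnonneg
  linarith

end MatrixAssumption

/-! ### The primal-dual inclusion -/

section Inclusion

variable {H : Type*} [NormedAddCommGroup H] [InnerProductSpace ℝ H] {n m : ℕ}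

/-- The matrix `N - D⁻¹`, through which a resolvent step depends on `x`. Its symmetric part is
`-S / 2`. -/
def lowerHalf (S : Matrix (Fin n) (Fin n) ℝ) : Matrix (Fin n) (Fin n) ℝ :=
  negLower S - (1 / 2 : ℝ) • Matrix.diagonal fun i => S i i

/-- The vector `(N - D⁻¹) x + M p - C β`. The resolvent steps of the algorithm say that it belongs
to `F x`, where `β` collects the forward evaluations of the `B j`. -/
def dualVec (M : Matrix (Fin n) (Fin (n - 1)) ℝ) (S : Matrix (Fin n) (Fin n) ℝ)
    (C : Matrix (Fin n) (Fin m) ℝ) (p : HilbertPow H (n - 1)) (β : HilbertPow H m)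
    (x : HilbertPow H n) : HilbertPow H n :=
  kron (lowerHalf S) x + kron M p - kron C β

/-- The pair `(p, a)` solves the primal-dual inclusion: `a` is a zero of the sum of the operators
and `p` is the fixed point of `opT` that certifies it. -/
def IsSolution (F : Fin n → H → Set H) (B : Fin m → H → H) (M : Matrix (Fin n) (Fin (n - 1)) ℝ)
    (S : Matrix (Fin n) (Fin n) ℝ) (C : Matrix (Fin n) (Fin m) ℝ) (p : HilbertPow H (n - 1))
    (a : H) : Prop :=
  dualVec M S C p (prodMap B (diagVec m a)) (diagVec n a) ∈ prodSet F (diagVec n a)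

variable {F : Fin n → H → Set H} {B : Fin m → H → H} {θ : ℝ} {Lc : Fin m → ℝ}
  {M : Matrix (Fin n) (Fin (n - 1)) ℝ} {S : Matrix (Fin n) (Fin n) ℝ}
  {C : Matrix (Fin n) (Fin m) ℝ} {Q : Matrix (Fin m) (Fin n) ℝ}

theorem lowerHalf_add_transpose (hS : S.IsSymm) : lowerHalf S + (lowerHalf S)ᵀ = -S := by
  ext i j
  have hij : S j i = S i j := hS.apply i j
  rcases lt_trichotomy i j with h | rfl | h
  · simp [lowerHalf, negLower, h, h.not_gt, h.ne, hij]
  · simp [lowerHalf, negLower]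
    ring
  · simp [lowerHalf, negLower, h, h.not_gt, h.ne']

theorem inner_kron_lowerHalf (hS : S.IsSymm) (x : HilbertPow H n) :
    inner ℝ (kron (lowerHalf S) x) x = -(1 / 2) * inner ℝ x (kron S x) := by
  have hsymm : inner ℝ x (kron (lowerHalf S + (lowerHalf S)ᵀ) x) = -inner ℝ x (kron S x) := by
    rw [lowerHalf_add_transpose hS, ← neg_one_smul ℝ S, smul_kron, real_inner_smul_right]
    ring
  rw [add_kron, inner_add_right, ← inner_kron, real_inner_comm] at hsymm
  linarith

theorem sum_kron_lowerHalf_diagVec (hS : S.IsSymm)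
    (hS0 : (fun _ => 1) ⬝ᵥ (S *ᵥ (fun _ => 1)) = 0) (a : H) :
    ∑ i, kron (lowerHalf S) (diagVec n a) i = 0 := by
  have hcomm : ∑ i, ∑ j, lowerHalf S i j = ∑ i, ∑ j, (lowerHalf S)ᵀ i j := Finset.sum_comm
  have hentries : ∑ i, ∑ j, lowerHalf S i j + ∑ i, ∑ j, lowerHalf S i j = 0 := by
    nth_rw 2 [hcomm]
    simp only [← Finset.sum_add_distrib, ← Matrix.add_apply, lowerHalf_add_transpose hS]
    simpa [dotProduct, Matrix.mulVec] using hS0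
  simp only [kron_apply, diagVec_apply, ← Finset.sum_smul, add_self_eq_zero.mp hentries,
    zero_smul]

theorem kron_negLower_apply (x : HilbertPow H n) (i : Fin n) :
    kron (negLower S) x i = -∑ j ∈ Finset.Iio i, S i j • x j := by
  simp only [kron_apply, negLower, Matrix.of_apply, ite_smul, neg_smul, zero_smul]
  rw [← Finset.sum_filter, ← Finset.sum_neg_distrib]
  exact Finset.sum_congr (by ext; simp) fun _ _ => rfl

theorem kron_lowerHalf_apply (x : HilbertPow H n) (i : Fin n) :
    kron (lowerHalf S) x i = -∑ j ∈ Finset.Iio i, S i j • x j - (S i i / 2) • x i := by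
  rw [lowerHalf, sub_kron, smul_kron, PiLp.sub_apply, PiLp.smul_apply, kron_negLower_apply]
  simp [Matrix.diagonal_apply, ite_smul, smul_smul, div_eq_inv_mul]

theorem mem_resolvent_stepSize_iff {i : Fin n} (hS : S i i ≠ 0) {A : H → Set H} {w x : H} :
    x ∈ resolvent (stepSize S i • A) (stepSize S i • w) ↔ w - (S i i / 2) • x ∈ A x := by
  have hd : stepSize S i ≠ 0 := mul_ne_zero two_ne_zero (inv_ne_zero hS)
  have hinv : (stepSize S i)⁻¹ = S i i / 2 := by
    rw [stepSize, mul_inv, inv_inv, inv_mul_eq_div]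
  rw [mem_resolvent_iff, Pi.smul_apply, Set.mem_smul_set_iff_inv_smul_mem₀ hd, smul_sub,
    inv_smul_smul₀ hd, hinv]

theorem mem_resolvent_prodSet_iff (hS : ∀ i, S i i ≠ 0) {p : HilbertPow H (n - 1)}
    {β : HilbertPow H m} {x : HilbertPow H n} :
    x ∈ resolvent (prodSet fun i => stepSize S i • F i)
        (kron (Matrix.diagonal (stepSize S) * negLower S) x +
          kron (Matrix.diagonal (stepSize S) * M) p - kron (Matrix.diagonal (stepSize S) * C) β) ↔
      dualVec M S C p β x ∈ prodSet F x := by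
  have hdiag : ∀ w : HilbertPow H n, ∀ i, kron (Matrix.diagonal (stepSize S)) w i =
      stepSize S i • w i := fun w i => by simp [Matrix.diagonal_apply, ite_smul]
  rw [mem_resolvent_iff]
  refine forall_congr' fun i => ?_
  rw [mul_kron, mul_kron, mul_kron, PiLp.sub_apply, PiLp.sub_apply, PiLp.add_apply, hdiag, hdiag,
    hdiag, ← smul_add, ← smul_sub, ← mem_resolvent_iff (x := x i),
    mem_resolvent_stepSize_iff (hS i), dualVec, PiLp.sub_apply, PiLp.add_apply,
    kron_lowerHalf_apply, kron_negLower_apply]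
  abel_nf

theorem mem_fixedPts_opT_iff [NeZero n] (h : MatrixAssumption θ Lc M S C Q)
    (hS : ∀ i, S i i ≠ 0) {γ : ℝ} (hγ : γ ≠ 0) {p : HilbertPow H (n - 1)} :
    p ∈ fixedPts (opT F B M S C Q γ) ↔ ∃ a, IsSolution F B M S C p a := by
  constructor
  · rintro ⟨x, hx, hp⟩
    have hMx : kron Mᵀ x = 0 := by
      rw [eq_comm, sub_eq_self] at hp
      exact (smul_eq_zero.mp hp).resolve_left hγ
    obtain ⟨a, rfl⟩ := exists_eq_diagVec_of_kron_transpose_eq_zero h.ker_le hMx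
    rw [mem_resolvent_prodSet_iff hS, kron_diagVec h.Q_ones, one_smul] at hx
    exact ⟨a, hx⟩
  · rintro ⟨a, ha⟩
    refine ⟨diagVec n a, (mem_resolvent_prodSet_iff hS).mpr ?_, ?_⟩
    · rwa [kron_diagVec h.Q_ones, one_smul]
    · rw [kron_diagVec (c := 0) h.M_transpose_mulVec_ones, zero_smul, smul_zero, sub_zero]

theorem MatrixAssumption.sum_dualVec (h : MatrixAssumption θ Lc M S C Q)
    (p : HilbertPow H (n - 1)) (β : HilbertPow H m) (a : H) :
    ∑ i, dualVec M S C p β (diagVec n a) i + ∑ j, β j = 0 := by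
  simp only [dualVec, PiLp.sub_apply, PiLp.add_apply, Finset.sum_sub_distrib,
    Finset.sum_add_distrib, sum_kron_lowerHalf_diagVec h.S_symm h.S_ones,
    sum_kron (c := 0) h.M_transpose_mulVec_ones, sum_kron h.C_ones, zero_smul, one_smul]
  abel

theorem IsSolution.mem_zer (h : MatrixAssumption θ Lc M S C Q) {p : HilbertPow H (n - 1)} {a : H}
    (hp : IsSolution F B M S C p a) : a ∈ zer (∑ i, F i + ∑ j, singleValued (B j)) :=
  mem_zer_iff.mpr ⟨_, hp, h.sum_dualVec p _ a⟩

theorem exists_isSolution_of_mem_zer [NeZero n] (h : MatrixAssumption θ Lc M S C Q) {a : H}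
    (ha : a ∈ zer (∑ i, F i + ∑ j, singleValued (B j))) : ∃ p, IsSolution F B M S C p a := by
  obtain ⟨f, hf, hsum⟩ := mem_zer_iff.mp ha
  set β := prodMap B (diagVec m a)
  obtain ⟨p, hp⟩ := exists_kron_eq_of_sum_eq_zero h.ker_le
    (w := WithLp.toLp 2 f - dualVec M S C 0 β (diagVec n a)) (by
      simp only [PiLp.sub_apply, Finset.sum_sub_distrib, sub_eq_zero]
      exact add_right_cancel (hsum.trans (h.sum_dualVec 0 β a).symm))
  refine ⟨p, ?_⟩
  have hdual : dualVec M S C p β (diagVec n a) = WithLp.toLp 2 f := by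
    rw [dualVec, hp, dualVec, kron_zero]
    abel
  rw [IsSolution, hdual]
  exact hf

theorem Causal.smul_partial_sum (h : Causal C Q) (x : HilbertPow H n) (u : H) (i : Fin n)
    (j : Fin m) (b : H → H) :
    C i j • b (∑ l ∈ Finset.Iio i, Q j l • x l + u) = C i j • b (kron Q x j + u) := by
  obtain ⟨A, hA, -, -, hC, hQ⟩ := h
  by_cases hj : (A i : ℕ) < j + 1
  · rw [hC i j hj, zero_smul, zero_smul]
  · rw [kron_apply, Finset.sum_subset (Finset.subset_univ (Finset.Iio i))]
    intro l _ hl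
    have hil : (A i : ℕ) ≤ A l := hA (by simpa using hl)
    rw [show Q j l = 0 from hQ l j (by omega), zero_smul]

theorem Causal.dualVec_apply_zero [NeZero n] (h : Causal C Q) (p : HilbertPow H (n - 1))
    (β : HilbertPow H m) (x : HilbertPow H n) :
    dualVec M S C p β x 0 = kron M p 0 - (S 0 0 / 2) • x 0 := by
  obtain ⟨A, -, hA, -, hC, -⟩ := h
  have hCβ : kron C β 0 = 0 := by
    rw [kron_apply]
    exact Finset.sum_eq_zero fun j _ => by rw [hC 0 j (by simp [hA 0 rfl]), zero_smul]
  have hIio : Finset.Iio (0 : Fin n) = ∅ := Finset.Iio_eq_empty.mpr fun j _ => Fin.zero_le j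
  rw [dualVec, PiLp.sub_apply, PiLp.add_apply, hCβ, kron_lowerHalf_apply, hIio,
    Finset.sum_empty]
  abel

theorem norm_sub_apply_zero_le_of_dualVec_mem [NeZero n] (hC : Causal C Q)
    (hF : MaximallyMonotone (F 0)) {p q : HilbertPow H (n - 1)} {β β' : HilbertPow H m}
    {x y : HilbertPow H n} (hx : dualVec M S C p β x ∈ prodSet F x)
    (hy : dualVec M S C q β' y ∈ prodSet F y) :
    S 0 0 / 2 * ‖x 0 - y 0‖ ≤ ‖kron M p 0 - kron M q 0‖ := by
  have hx0 := hx 0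
  have hy0 := hy 0
  rw [hC.dualVec_apply_zero] at hx0 hy0
  exact hF.mul_norm_sub_le hx0 hy0

theorem IsSolution.unique [NeZero n] (hC : Causal C Q) (hS : 0 < S 0 0)
    (hF : MaximallyMonotone (F 0)) {p : HilbertPow H (n - 1)} {a a' : H}
    (h : IsSolution F B M S C p a) (h' : IsSolution F B M S C p a') : a = a' := by
  have hle := norm_sub_apply_zero_le_of_dualVec_mem hC hF h h'
  rw [sub_self, norm_zero] at hle
  exact sub_eq_zero.mp (norm_le_zero_iff.mp (nonpos_of_mul_nonpos_right hle (half_pos hS)))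

namespace IsGenerated

variable {γ ξ : ℕ → ℝ} {x : ℕ → HilbertPow H n} {z : ℕ → HilbertPow H (n - 1)}
  {u : ℕ → HilbertPow H m} {v : ℕ → HilbertPow H (n - 1)}

theorem dualVec_mem (h : IsGenerated F B Lc M S C Q θ γ ξ x z u v) (hC : Causal C Q)
    (hS : ∀ i, S i i ≠ 0) (k : ℕ) :
    dualVec M S C (z k + v k) (prodMap B (kron Q (x k) + u k)) (x k) ∈ prodSet F (x k) := by
  intro i
  have hstep := h.x_step k i
  rw [← smul_neg, ← smul_add, ← smul_sub, mem_resolvent_stepSize_iff (hS i)] at hstep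
  convert hstep using 1
  simp only [dualVec, PiLp.sub_apply, PiLp.add_apply, kron_lowerHalf_apply, hC.smul_partial_sum]
  simp only [kron_apply, PiLp.add_apply, prodMap]
  abel

theorem z_succ (h : IsGenerated F B Lc M S C Q θ γ ξ x z u v) (k : ℕ) :
    z (k + 1) = z k - γ k • kron Mᵀ (x k) := by
  ext i
  simpa using h.z_step k i

end IsGenerated

end Inclusion

/-! ### The descent inequality -/

section Descent

variable {E : Type*} [NormedAddCommGroup E] [InnerProductSpace ℝ E]

theorem norm_sub_sq_le_of_pos {θ : ℝ} (hθ : 0 < θ) (u e : E) :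
    ‖u - e‖ ^ 2 ≤ (1 + 1 / θ) * ‖e‖ ^ 2 + (1 + θ) * ‖u‖ ^ 2 := by
  have hsq : 0 ≤ ‖θ • u + e‖ ^ 2 / θ := by positivity
  have hexpand : ‖θ • u + e‖ ^ 2 / θ = θ * ‖u‖ ^ 2 + 2 * inner ℝ u e + 1 / θ * ‖e‖ ^ 2 := by
    rw [norm_add_sq_real, norm_smul, Real.norm_of_nonneg hθ.le, real_inner_smul_left]
    field_simp
  rw [norm_sub_sq_real]
  linarith

theorem Cocoercive.inner_sub_sub_le {L : ℝ} (hL : 0 < L) {B : E → E}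
    (hB : Cocoercive (1 / L) B) (x y w : E) :
    inner ℝ (B x - B y) (w - (x - y)) ≤ L / 4 * ‖w‖ ^ 2 := by
  have hsq : 0 ≤ ‖(B x - B y) - (L / 2) • w‖ ^ 2 / L := by positivity
  have hexpand : ‖(B x - B y) - (L / 2) • w‖ ^ 2 / L =
      1 / L * ‖B x - B y‖ ^ 2 - inner ℝ (B x - B y) w + L / 4 * ‖w‖ ^ 2 := by
    rw [norm_sub_sq_real, norm_smul, Real.norm_of_nonneg (half_pos hL).le, real_inner_smul_right]
    field_simp
    ring
  rw [inner_sub_right]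
  linarith [hB x y]

theorem norm_sub_sq_le_of_step {γ c : ℝ} (hγ0 : 0 < γ) (hγ1 : γ < 1) {z z' v p g : E}
    (hz : z' = z - γ • g) (hg : ‖g‖ ^ 2 ≤ 2 * inner ℝ (z + v - p) g + c) :
    ‖z' - p‖ ^ 2 ≤ ‖z - p‖ ^ 2 - (1 - γ) / γ * ‖z' - z + (γ / (1 - γ)) • v‖ ^ 2 +
      (γ / (1 - γ) * ‖v‖ ^ 2 + γ * c) := by
  have hγ1' : 0 < 1 - γ := sub_pos.mpr hγ1
  have hdist : ‖z' - p‖ ^ 2 = ‖z - p‖ ^ 2 - 2 * γ * inner ℝ (z - p) g + γ ^ 2 * ‖g‖ ^ 2 := by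
    rw [hz, sub_right_comm, norm_sub_sq_real, norm_smul, Real.norm_of_nonneg hγ0.le,
      real_inner_smul_right]
    ring
  have hres : (1 - γ) / γ * ‖z' - z + (γ / (1 - γ)) • v‖ ^ 2 =
      γ / (1 - γ) * ‖v‖ ^ 2 - 2 * γ * inner ℝ v g + γ * (1 - γ) * ‖g‖ ^ 2 := by
    rw [show z' - z + (γ / (1 - γ)) • v = (γ / (1 - γ)) • v - γ • g by rw [hz]; abel,
      norm_sub_sq_real, norm_smul, norm_smul, Real.norm_of_nonneg hγ0.le,
      Real.norm_of_nonneg (by positivity), real_inner_smul_right, real_inner_smul_left]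
    field_simp
  rw [add_sub_right_comm, inner_add_left] at hg
  rw [hdist, hres]
  linarith [mul_le_mul_of_nonneg_left hg hγ0.le]

theorem summable_and_tendsto_of_lyapunov {ε : ℝ} (hε : 0 < ε) {a e l ξ : ℕ → ℝ}
    (ha : ∀ k, 0 ≤ a k) (he : ∀ k, 0 ≤ e k) (hl : ∀ k, 0 ≤ l k) (hξ : ∀ k, ξ k ≤ 1 - ε)
    (hstep : ∀ k, a (k + 1) ≤ a k - l k + e k) (hdev : ∀ k, e (k + 1) ≤ ξ k * l k) :
    Summable l ∧ Tendsto e atTop (𝓝 0) ∧ ∃ c, Tendsto a atTop (𝓝 c) := by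
  have hdev' (k : ℕ) : e (k + 1) ≤ (1 - ε) * l k :=
    (hdev k).trans (mul_le_mul_of_nonneg_right (hξ k) (hl k))
  -- `a + e` is a Lyapunov function, with decrease at least `ε * l`.
  have hdecr (k : ℕ) : ε * l k ≤ (a k + e k) - (a (k + 1) + e (k + 1)) := by
    linarith [hstep k, hdev' k]
  have hsum : Summable l := by
    refine (summable_mul_left_iff hε.ne').mp
      (summable_of_sum_range_le (c := a 0 + e 0) (fun k => mul_nonneg hε.le (hl k)) fun N => ?_)
    refine (Finset.sum_le_sum fun k _ => hdecr k).trans ?_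
    rw [Finset.sum_range_sub' (fun k => a k + e k)]
    linarith [ha N, he N]
  have he0 : Tendsto e atTop (𝓝 0) := by
    rw [← tendsto_add_atTop_iff_nat 1]
    exact squeeze_zero (fun k => he (k + 1)) hdev'
      (by simpa using hsum.tendsto_atTop_zero.const_mul (1 - ε))
  have hanti : Antitone fun k => a k + e k := antitone_nat_of_succ_le fun k => by
    linarith [hdecr k, mul_nonneg hε.le (hl k)]
  have hbdd : BddBelow (Set.range fun k => a k + e k) :=
    ⟨0, by rintro _ ⟨k, rfl⟩; exact add_nonneg (ha k) (he k)⟩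
  exact ⟨hsum, he0, _, by simpa using (tendsto_atTop_ciInf hanti hbdd).sub he0⟩

variable {H : Type*} [NormedAddCommGroup H] [InnerProductSpace ℝ H] {n m : ℕ}
  {F : Fin n → H → Set H} {B : Fin m → H → H} {θ : ℝ} {Lc : Fin m → ℝ}
  {M : Matrix (Fin n) (Fin (n - 1)) ℝ} {S : Matrix (Fin n) (Fin n) ℝ}
  {C : Matrix (Fin n) (Fin m) ℝ} {Q : Matrix (Fin m) (Fin n) ℝ}

theorem weightedNormSq_Linv_nonneg (hLc : ∀ j, 0 < Lc j) (w : HilbertPow H m) :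
    0 ≤ weightedNormSq (Linv Lc) w := by
  rw [weightedNormSq_Linv]
  exact Finset.sum_nonneg fun j _ => mul_nonneg (hLc j).le (sq_nonneg _)

theorem weightedNormSq_Linv_sub_le (hθ : 0 < θ) (hLc : ∀ j, 0 < Lc j) (u e : HilbertPow H m) :
    weightedNormSq (Linv Lc) (u - e) ≤
      (1 + 1 / θ) * weightedNormSq (Linv Lc) e + (1 + θ) * weightedNormSq (Linv Lc) u := by
  simp only [weightedNormSq_Linv, Finset.mul_sum, ← Finset.sum_add_distrib]
  refine Finset.sum_le_sum fun j _ => ?_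
  have hj := mul_le_mul_of_nonneg_left (norm_sub_sq_le_of_pos hθ (u j) (e j)) (hLc j).le
  rw [PiLp.sub_apply]
  linarith

theorem inner_prodMap_sub_le (hLc : ∀ j, 0 < Lc j) (hB : ∀ j, Cocoercive (1 / Lc j) (B j))
    (y y' w : HilbertPow H m) :
    inner ℝ (prodMap B y - prodMap B y') (w - (y - y')) ≤
      1 / 4 * weightedNormSq (Linv Lc) w := by
  rw [weightedNormSq_Linv, PiLp.inner_apply, Finset.mul_sum]
  refine Finset.sum_le_sum fun j _ => ((hB j).inner_sub_sub_le (hLc j) (y j) (y' j) (w j)).trans ?_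
  exact le_of_eq (by ring)

theorem IsSolution.norm_sq_le (h : MatrixAssumption θ Lc M S C Q) (hθ : 0 < θ)
    (hLc : ∀ j, 0 < Lc j) (hF : ∀ i, MaximallyMonotone (F i))
    (hB : ∀ j, Cocoercive (1 / Lc j) (B j)) {p w : HilbertPow H (n - 1)} {a : H}
    (hp : IsSolution F B M S C p a) {x : HilbertPow H n} {u : HilbertPow H m}
    (hx : dualVec M S C w (prodMap B (kron Q x + u)) x ∈ prodSet F x) :
    ‖kron Mᵀ x‖ ^ 2 ≤
      2 * inner ℝ (w - p) (kron Mᵀ x) + (1 + θ) / 2 * weightedNormSq (Linv Lc) u := by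
  set δ := x - diagVec n a with hδ
  set β := prodMap B (kron Q x + u) - prodMap B (diagVec m a) with hβ
  set e := kron (Cᵀ - Q) δ with he
  have hMδ : kron Mᵀ δ = kron Mᵀ x := by
    rw [hδ, kron_sub, kron_diagVec (c := 0) h.M_transpose_mulVec_ones, zero_smul, sub_zero]
  have hdual : dualVec M S C w (prodMap B (kron Q x + u)) x -
      dualVec M S C p (prodMap B (diagVec m a)) (diagVec n a) =
      kron (lowerHalf S) δ + kron M (w - p) - kron C β := by
    rw [hδ, hβ, kron_sub, kron_sub, kron_sub, dualVec, dualVec]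
    abel
  have hmono : 0 ≤ -(1 / 2) * inner ℝ δ (kron S δ) + inner ℝ (w - p) (kron Mᵀ x) -
      inner ℝ β (kron Cᵀ δ) := by
    have hnonneg := inner_nonneg_of_mem_prodSet hF hx hp
    rwa [hdual, inner_sub_left, inner_add_left, inner_kron_lowerHalf h.S_symm, inner_kron M, hMδ,
      inner_kron C] at hnonneg
  have hS := h.le_inner_kron_S δ
  rw [hMδ] at hS
  have hshift : u - e - (kron Q x + u - diagVec m a) = -kron Cᵀ δ := by
    rw [he, sub_kron, hδ, kron_sub Q, kron_diagVec h.Q_ones, one_smul]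
    abel
  have hcoco := inner_prodMap_sub_le hLc hB (kron Q x + u) (diagVec m a) (u - e)
  rw [hshift, inner_neg_right, ← hβ] at hcoco
  linarith [weightedNormSq_Linv_sub_le hθ hLc u e]

end Descent

/-! ### Boundedness and weak cluster points -/

section Cluster

variable {H : Type*} [NormedAddCommGroup H] [InnerProductSpace ℝ H] {n m : ℕ}
  {F : Fin n → H → Set H} {B : Fin m → H → H} {θ : ℝ} {Lc : Fin m → ℝ}
  {M : Matrix (Fin n) (Fin (n - 1)) ℝ} {S : Matrix (Fin n) (Fin n) ℝ}
  {C : Matrix (Fin n) (Fin m) ℝ} {Q : Matrix (Fin m) (Fin n) ℝ}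
  {ι : Type*} {l : Filter ι} {w : ι → HilbertPow H (n - 1)} {β : ι → HilbertPow H m}
  {x : ι → HilbertPow H n} {u : ι → HilbertPow H m} {p : HilbertPow H (n - 1)} {a : H}

theorem isBigO_one_prodMap {b : ι → HilbertPow H m} {K : Fin m → NNReal}
    (hB : ∀ j, LipschitzWith (K j) (B j)) (hb : b =O[l] fun _ => (1 : ℝ)) :
    (fun k => prodMap B (b k)) =O[l] fun _ => (1 : ℝ) := by
  refine isBigO_of_forall_apply fun j => ?_
  have hdiff : (fun k => B j (b k j) - B j 0) =O[l] fun _ => (1 : ℝ) :=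
    calc (fun k => B j (b k j) - B j 0) =O[l] fun k => b k j :=
          IsBigO.of_bound (K j) (.of_forall fun k => by
            simpa only [sub_zero] using (hB j).norm_sub_le (b k j) 0)
      _ =O[l] b := isBigO_apply b j
      _ =O[l] fun _ => (1 : ℝ) := hb
  have hBj : (fun k => B j (b k j)) =O[l] fun _ => (1 : ℝ) := by
    simpa only [sub_add_cancel] using hdiff.add (isBigO_const_const (B j 0) one_ne_zero l)
  exact hBj

theorem isBigO_one_of_tendsto_kron_transpose [NeZero n] (h : MatrixAssumption θ Lc M S C Q)
    (hS : 0 < S 0 0) (hF : MaximallyMonotone (F 0)) (hp : IsSolution F B M S C p a)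
    (hw : w =O[l] fun _ => (1 : ℝ)) (hmem : ∀ k, dualVec M S C (w k) (β k) (x k) ∈ prodSet F (x k))
    (hx : Tendsto (fun k => kron Mᵀ (x k)) l (𝓝 0)) : x =O[l] fun _ => (1 : ℝ) := by
  have hMw : (fun k => kron M (w k) 0 - kron M p 0) =O[l] fun _ => (1 : ℝ) := by
    have hkron : (fun k => kron M (w k) 0) =O[l] w :=
      (isBigO_apply (fun k => kron M (w k)) 0).trans ((kronCLM M).isBigO_comp w l)
    exact (hkron.trans hw).sub (isBigO_const_const (kron M p 0) one_ne_zero l)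
  have hfirst : (fun k => x k 0 - a) =O[l] fun _ => (1 : ℝ) := by
    refine (IsBigO.of_bound (S 0 0 / 2)⁻¹ (.of_forall fun k => ?_)).trans hMw
    rw [le_inv_mul_iff₀ (half_pos hS)]
    exact norm_sub_apply_zero_le_of_dualVec_mem h.causal hF (hmem k) hp
  refine isBigO_of_forall_apply fun i => ?_
  have hdiff := (tendsto_sub_apply_of_tendsto_kron_transpose h.ker_le hx i 0).isBigO_one ℝ
  simpa using (hdiff.add hfirst).add (isBigO_const_const a one_ne_zero l)

theorem inner_dualVec_add_inner (hS : S.IsSymm) (q : HilbertPow H (n - 1)) (s b : HilbertPow H m)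
    (y : HilbertPow H n) : inner ℝ (dualVec M S C q s y) y + inner ℝ s b =
      -(1 / 2) * inner ℝ y (kron S y) + inner ℝ q (kron Mᵀ y) + inner ℝ s (b - kron Cᵀ y) := by
  rw [dualVec, inner_sub_left, inner_add_left, inner_kron_lowerHalf hS, inner_kron M,
    inner_kron C, inner_sub_right]
  ring

namespace MatrixAssumption

theorem inner_dualVec_diagVec (h : MatrixAssumption θ Lc M S C Q) (q : HilbertPow H (n - 1))
    (s : HilbertPow H m) (a : H) :
    inner ℝ (dualVec M S C q s (diagVec n a)) (diagVec n a) + inner ℝ s (diagVec m a) = 0 := by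
  rw [inner_dualVec_add_inner h.S_symm, kron_diagVec (c := 0) h.S_mulVec_ones,
    kron_diagVec (c := 0) h.M_transpose_mulVec_ones, kron_diagVec h.C_ones]
  simp

theorem tendsto_inner_dualVec (h : MatrixAssumption θ Lc M S C Q)
    (hw : w =O[l] fun _ => (1 : ℝ)) (hβ : β =O[l] fun _ => (1 : ℝ))
    (hxb : x =O[l] fun _ => (1 : ℝ)) (hu : Tendsto u l (𝓝 0))
    (hx : Tendsto (fun k => kron Mᵀ (x k)) l (𝓝 0)) :
    Tendsto (fun k => inner ℝ (dualVec M S C (w k) (β k) (x k)) (x k) +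
      inner ℝ (β k) (kron Q (x k) + u k)) l (𝓝 0) := by
  have hSx := tendsto_kron_zero_of_tendsto_kron_transpose h.ker_le h.S_mulVec_ones hx
  have hres : Tendsto (fun k => kron Q (x k) + u k - kron Cᵀ (x k)) l (𝓝 0) := by
    have hCQ := tendsto_kron_zero_of_tendsto_kron_transpose h.ker_le h.sub_mulVec_ones hx
    have hdiff := hu.sub hCQ
    rw [sub_zero] at hdiff
    refine hdiff.congr fun k => ?_
    rw [sub_kron]
    abel
  simp only [inner_dualVec_add_inner h.S_symm]
  simpa only [mul_zero, add_zero] using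
    (((tendsto_inner_zero_of_isBigO_one hxb hSx).const_mul (-(1 / 2))).add
      (tendsto_inner_zero_of_isBigO_one hw hx)).add (tendsto_inner_zero_of_isBigO_one hβ hres)

end MatrixAssumption

theorem TendstoWeakly.apply {q : ℕ} {y : ι → HilbertPow H q} {y' : HilbertPow H q}
    (h : TendstoWeakly y l y') (i : Fin q) : TendstoWeakly (fun k => y k i) l (y' i) :=
  h.map (PiLp.proj 2 (fun _ : Fin q => H) i)

theorem TendstoWeakly.dualVec {β' : HilbertPow H m} {x' : HilbertPow H n}
    (hw : TendstoWeakly w l p) (hβ : TendstoWeakly β l β') (hx : TendstoWeakly x l x') :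
    TendstoWeakly (fun k => dualVec M S C (w k) (β k) (x k)) l (dualVec M S C p β' x') :=
  ((hx.map (kronCLM (lowerHalf S))).add (hw.map (kronCLM M))).sub (hβ.map (kronCLM C))

theorem isSolution_of_tendstoWeakly [l.NeBot] (h : MatrixAssumption θ Lc M S C Q)
    (hF : ∀ i, MaximallyMonotone (F i)) (hLc : ∀ j, 0 < Lc j)
    (hB : ∀ j, Cocoercive (1 / Lc j) (B j)) {b : ι → HilbertPow H m} {β' : HilbertPow H m}
    (hw : TendstoWeakly w l p) (hx : TendstoWeakly x l (diagVec n a))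
    (hb : TendstoWeakly b l (diagVec m a)) (hβ : TendstoWeakly (fun k => prodMap B (b k)) l β')
    (hmem : ∀ k, dualVec M S C (w k) (prodMap B (b k)) (x k) ∈ prodSet F (x k))
    (hlim : Tendsto (fun k => inner ℝ (dualVec M S C (w k) (prodMap B (b k)) (x k)) (x k) +
      inner ℝ (prodMap B (b k)) (b k)) l (𝓝 0)) :
    IsSolution F B M S C p a := by
  have hdual : TendstoWeakly (fun k => dualVec M S C (w k) (prodMap B (b k)) (x k)) l
      (dualVec M S C p β' (diagVec n a)) := hw.dualVec hβ hx
  have hgraph := mem_of_tendstoWeakly_of_tendsto_sum_inner (l := l)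
    (A := Sum.elim F fun j => singleValued (B j))
    (x := fun k => Sum.elim (x k) (b k)) (x' := Sum.elim (diagVec n a) (diagVec m a))
    (u := fun k => Sum.elim (dualVec M S C (w k) (prodMap B (b k)) (x k)) (prodMap B (b k)))
    (u' := Sum.elim (dualVec M S C p β' (diagVec n a)) β')
    (Sum.rec hF fun j => (hB j).maximallyMonotone (one_div_pos.mpr (hLc j)))
    (fun k => Sum.rec (hmem k) fun j => rfl)
    (Sum.rec hx.apply hb.apply) (Sum.rec hdual.apply hβ.apply) (by
      simpa only [Fintype.sum_sum_type, Sum.elim_inl, Sum.elim_inr, ← PiLp.inner_apply,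
        h.inner_dualVec_diagVec] using hlim)
  have hβ' : β' = prodMap B (diagVec m a) := PiLp.ext fun j => hgraph (Sum.inr j)
  rw [IsSolution, ← hβ']
  exact fun i => hgraph (Sum.inl i)

theorem exists_isSolution_of_tendstoWeakly [CompleteSpace H] [NeZero n] {U : Ultrafilter ι}
    (h : MatrixAssumption θ Lc M S C Q) (hF : ∀ i, MaximallyMonotone (F i))
    (hLc : ∀ j, 0 < Lc j) (hB : ∀ j, Cocoercive (1 / Lc j) (B j))
    (hwb : w =O[(U : Filter ι)] fun _ => (1 : ℝ)) (hxb : x =O[(U : Filter ι)] fun _ => (1 : ℝ))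
    (hu : Tendsto u U (𝓝 0)) (hx : Tendsto (fun k => kron Mᵀ (x k)) U (𝓝 0))
    (hmem : ∀ k, dualVec M S C (w k) (prodMap B (kron Q (x k) + u k)) (x k) ∈ prodSet F (x k))
    (hw : TendstoWeakly w U p) :
    ∃ a, IsSolution F B M S C p a ∧ TendstoWeakly x U (diagVec n a) := by
  obtain ⟨x', hx'⟩ := exists_tendstoWeakly_of_isBigO_one U hxb
  obtain ⟨a, rfl⟩ := exists_eq_diagVec_of_kron_transpose_eq_zero h.ker_le
    ((hx'.map (kronCLM Mᵀ)).unique (tendstoWeakly_of_tendsto hx))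
  have hb : TendstoWeakly (fun k => kron Q (x k) + u k) U (diagVec m a) := by
    simpa only [kronCLM_apply, kron_diagVec h.Q_ones, one_smul, add_zero] using
      (hx'.map (kronCLM Q)).add (tendstoWeakly_of_tendsto hu)
  have hβb : (fun k => prodMap B (kron Q (x k) + u k)) =O[(U : Filter ι)] fun _ => (1 : ℝ) :=
    isBigO_one_prodMap (fun j => (hB j).lipschitzWith (one_div_pos.mpr (hLc j)))
      ((((kronCLM Q).isBigO_comp x U).trans hxb).add (hu.isBigO_one ℝ))
  obtain ⟨β', hβ⟩ := exists_tendstoWeakly_of_isBigO_one U hβb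
  exact ⟨a, isSolution_of_tendstoWeakly h hF hLc hB hw hx' hb hβ hmem
    (h.tendsto_inner_dualVec hwb hβb hxb hu hx), hx'⟩

end Cluster

/-! ### Convergence of the algorithm -/

section Convergence

variable {H : Type*} [NormedAddCommGroup H] [InnerProductSpace ℝ H] {n m : ℕ}
  {F : Fin n → H → Set H} {B : Fin m → H → H} {ε θ : ℝ} {γ ξ : ℕ → ℝ} {Lc : Fin m → ℝ}
  {M : Matrix (Fin n) (Fin (n - 1)) ℝ} {S : Matrix (Fin n) (Fin n) ℝ}
  {C : Matrix (Fin n) (Fin m) ℝ} {Q : Matrix (Fin m) (Fin n) ℝ}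
  {x : ℕ → HilbertPow H n} {z : ℕ → HilbertPow H (n - 1)}
  {u : ℕ → HilbertPow H m} {v : ℕ → HilbertPow H (n - 1)}

/-- The size of the deviations at step `k`, which the safeguard of the algorithm compares with
`lSq`. -/
def deviationSq (θ : ℝ) (Lc : Fin m → ℝ) (γ : ℕ → ℝ) (u : ℕ → HilbertPow H m)
    (v : ℕ → HilbertPow H (n - 1)) (k : ℕ) : ℝ :=
  γ k / (1 - γ k) * ‖v k‖ ^ 2 + γ k * (1 + θ) / 2 * weightedNormSq (Linv Lc) (u k)

namespace ParameterAssumption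

theorem gamma_pos (h : ParameterAssumption ε θ γ ξ) (k : ℕ) : 0 < γ k :=
  h.eps_pos.trans_le (h.gamma_mem k).1

theorem eps_le_one_sub_gamma (h : ParameterAssumption ε θ γ ξ) (k : ℕ) : ε ≤ 1 - γ k :=
  le_sub_comm.mp (h.gamma_mem k).2

theorem one_sub_gamma_pos (h : ParameterAssumption ε θ γ ξ) (k : ℕ) : 0 < 1 - γ k :=
  h.eps_pos.trans_le (h.eps_le_one_sub_gamma k)

theorem eps_le_gamma_div (h : ParameterAssumption ε θ γ ξ) (k : ℕ) : ε ≤ γ k / (1 - γ k) :=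
  (h.gamma_mem k).1.trans
    (le_div_self (h.gamma_pos k).le (h.one_sub_gamma_pos k) (by linarith [h.gamma_pos k]))

theorem eps_le_div_gamma (h : ParameterAssumption ε θ γ ξ) (k : ℕ) : ε ≤ (1 - γ k) / γ k :=
  (h.eps_le_one_sub_gamma k).trans
    (le_div_self (h.one_sub_gamma_pos k).le (h.gamma_pos k) (by linarith [h.one_sub_gamma_pos k]))

theorem gamma_div_le (h : ParameterAssumption ε θ γ ξ) (k : ℕ) : γ k / (1 - γ k) ≤ ε⁻¹ := by
  rw [← one_div]
  exact div_le_div₀ zero_le_one (by linarith [h.one_sub_gamma_pos k]) h.eps_pos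
    (h.eps_le_one_sub_gamma k)

theorem mul_norm_sq_le_lSq (h : ParameterAssumption ε θ γ ξ) (k : ℕ) :
    ε * ‖z (k + 1) - z k + (γ k / (1 - γ k)) • v k‖ ^ 2 ≤ lSq γ z v k :=
  mul_le_mul_of_nonneg_right (h.eps_le_div_gamma k) (sq_nonneg _)

theorem mul_norm_v_sq_le (h : ParameterAssumption ε θ γ ξ) (hLc : ∀ j, 0 < Lc j) (k : ℕ) :
    ε * ‖v k‖ ^ 2 ≤ deviationSq θ Lc γ u v k := by
  have hu : 0 ≤ γ k * (1 + θ) / 2 * weightedNormSq (Linv Lc) (u k) := by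
    have hγ := h.gamma_pos k
    have hθ := h.theta_pos
    have hW := weightedNormSq_Linv_nonneg hLc (u k)
    positivity
  exact (mul_le_mul_of_nonneg_right (h.eps_le_gamma_div k) (sq_nonneg _)).trans
    (le_add_of_nonneg_right hu)

theorem mul_weightedNormSq_le (h : ParameterAssumption ε θ γ ξ) (hLc : ∀ j, 0 < Lc j) (k : ℕ) :
    ε / 2 * weightedNormSq (Linv Lc) (u k) ≤ deviationSq θ Lc γ u v k := by
  have hcoeff : ε / 2 ≤ γ k * (1 + θ) / 2 := by
    linarith [(h.gamma_mem k).1, mul_pos (h.gamma_pos k) h.theta_pos]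
  have hv : 0 ≤ γ k / (1 - γ k) * ‖v k‖ ^ 2 :=
    mul_nonneg (h.eps_pos.le.trans (h.eps_le_gamma_div k)) (sq_nonneg _)
  exact (mul_le_mul_of_nonneg_right hcoeff (weightedNormSq_Linv_nonneg hLc (u k))).trans
    (le_add_of_nonneg_left hv)

theorem tendsto_v (h : ParameterAssumption ε θ γ ξ) (hLc : ∀ j, 0 < Lc j)
    (hdev : Tendsto (deviationSq θ Lc γ u v) atTop (𝓝 0)) : Tendsto v atTop (𝓝 0) :=
  tendsto_zero_of_mul_norm_sq_le h.eps_pos (h.mul_norm_v_sq_le hLc) hdev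

theorem tendsto_u (h : ParameterAssumption ε θ γ ξ) (hLc : ∀ j, 0 < Lc j)
    (hdev : Tendsto (deviationSq θ Lc γ u v) atTop (𝓝 0)) : Tendsto u atTop (𝓝 0) := by
  have hcoord (j : Fin m) : Tendsto (fun k => u k j) atTop (𝓝 0) := by
    refine tendsto_zero_of_mul_norm_sq_le (mul_pos (half_pos h.eps_pos) (hLc j)) (fun k => ?_) hdev
    have hsingle : Lc j * ‖u k j‖ ^ 2 ≤ weightedNormSq (Linv Lc) (u k) := by
      rw [weightedNormSq_Linv]
      exact Finset.single_le_sum (f := fun j => Lc j * ‖u k j‖ ^ 2)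
        (fun i _ => mul_nonneg (hLc i).le (sq_nonneg _)) (Finset.mem_univ j)
    rw [mul_assoc]
    exact (mul_le_mul_of_nonneg_left hsingle (half_pos h.eps_pos).le).trans
      (h.mul_weightedNormSq_le hLc k)
  exact ((PiLp.continuous_toLp 2 fun _ : Fin m => H).tendsto 0).comp (tendsto_pi_nhds.mpr hcoord)

theorem tendsto_z_succ_sub (h : ParameterAssumption ε θ γ ξ) (hl : Summable (lSq γ z v))
    (hv : Tendsto v atTop (𝓝 0)) : Tendsto (fun k => z (k + 1) - z k) atTop (𝓝 0) := by
  have hsum : Tendsto (fun k => z (k + 1) - z k + (γ k / (1 - γ k)) • v k) atTop (𝓝 0) :=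
    tendsto_zero_of_mul_norm_sq_le h.eps_pos h.mul_norm_sq_le_lSq hl.tendsto_atTop_zero
  have hγv : Tendsto (fun k => (γ k / (1 - γ k)) • v k) atTop (𝓝 0) := by
    refine squeeze_zero_norm (fun k => ?_) (by simpa using hv.norm.const_mul ε⁻¹)
    rw [norm_smul, Real.norm_of_nonneg (h.eps_pos.le.trans (h.eps_le_gamma_div k))]
    exact mul_le_mul_of_nonneg_right (h.gamma_div_le k) (norm_nonneg _)
  simpa using hsum.sub hγv

end ParameterAssumption

namespace IsGenerated

theorem tendsto_kron_transpose (h : IsGenerated F B Lc M S C Q θ γ ξ x z u v)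
    (hpar : ParameterAssumption ε θ γ ξ) (hz : Tendsto (fun k => z (k + 1) - z k) atTop (𝓝 0)) :
    Tendsto (fun k => kron Mᵀ (x k)) atTop (𝓝 0) := by
  refine squeeze_zero_norm (fun k => ?_) (by simpa using hz.norm.const_mul ε⁻¹)
  rw [h.z_succ k, sub_sub_cancel_left, norm_neg, norm_smul,
    Real.norm_of_nonneg (hpar.gamma_pos k).le, le_inv_mul_iff₀ hpar.eps_pos]
  exact mul_le_mul_of_nonneg_right (hpar.gamma_mem k).1 (norm_nonneg _)

theorem summable_lSq_and_tendsto (h : IsGenerated F B Lc M S C Q θ γ ξ x z u v)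
    (hmat : MatrixAssumption θ Lc M S C Q) (hpar : ParameterAssumption ε θ γ ξ)
    (hS : ∀ i, S i i ≠ 0) (hF : ∀ i, MaximallyMonotone (F i)) (hLc : ∀ j, 0 < Lc j)
    (hB : ∀ j, Cocoercive (1 / Lc j) (B j)) {p : HilbertPow H (n - 1)} {a : H}
    (hp : IsSolution F B M S C p a) :
    Summable (lSq γ z v) ∧ Tendsto (deviationSq θ Lc γ u v) atTop (𝓝 0) ∧
      ∃ r, Tendsto (fun k => ‖z k - p‖) atTop (𝓝 r) := by
  have hstep (k : ℕ) : ‖z (k + 1) - p‖ ^ 2 ≤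
      ‖z k - p‖ ^ 2 - lSq γ z v k + deviationSq θ Lc γ u v k := by
    have hdescent := norm_sub_sq_le_of_step (hpar.gamma_pos k)
      (sub_pos.mp (hpar.one_sub_gamma_pos k)) (h.z_succ k)
      (hp.norm_sq_le hmat hpar.theta_pos hLc hF hB (h.dualVec_mem hmat.causal hS k))
    rw [lSq, deviationSq]
    linarith
  obtain ⟨hl, hdev, c, hc⟩ := summable_and_tendsto_of_lyapunov hpar.eps_pos
    (fun k => sq_nonneg ‖z k - p‖)
    (fun k => (mul_nonneg hpar.eps_pos.le (sq_nonneg _)).trans (hpar.mul_norm_v_sq_le hLc k))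
    (fun k => (mul_nonneg hpar.eps_pos.le (sq_nonneg _)).trans (hpar.mul_norm_sq_le_lSq k))
    (fun k => (hpar.xi_mem k).2) hstep h.deviation_le
  exact ⟨hl, hdev, √c, by simpa using hc.sqrt⟩

theorem exists_isSolution_of_tendstoWeakly [CompleteSpace H] [NeZero n]
    (h : IsGenerated F B Lc M S C Q θ γ ξ x z u v) (hmat : MatrixAssumption θ Lc M S C Q)
    (hS : ∀ i, 0 < S i i) (hF : ∀ i, MaximallyMonotone (F i)) (hLc : ∀ j, 0 < Lc j)
    (hB : ∀ j, Cocoercive (1 / Lc j) (B j)) {p₀ : HilbertPow H (n - 1)} {a₀ : H}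
    (hp₀ : IsSolution F B M S C p₀ a₀) {r : ℝ}
    (hz : Tendsto (fun k => ‖z k - p₀‖) atTop (𝓝 r)) (hu : Tendsto u atTop (𝓝 0))
    (hv : Tendsto v atTop (𝓝 0)) (hx : Tendsto (fun k => kron Mᵀ (x k)) atTop (𝓝 0))
    {U : Ultrafilter ℕ} (hU : (U : Filter ℕ) ≤ atTop) {p : HilbertPow H (n - 1)}
    (hp : TendstoWeakly z U p) :
    ∃ a, IsSolution F B M S C p a ∧ TendstoWeakly x U (diagVec n a) := by
  have hmem := h.dualVec_mem hmat.causal fun i => (hS i).ne'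
  have hwb : (fun k => z k + v k) =O[atTop] fun _ => (1 : ℝ) :=
    (isBigO_one_of_tendsto_norm_sub hz).add (hv.isBigO_one ℝ)
  have hxb : x =O[atTop] fun _ => (1 : ℝ) :=
    isBigO_one_of_tendsto_kron_transpose hmat (hS 0) (hF 0) hp₀ hwb hmem hx
  have hw : TendstoWeakly (fun k => z k + v k) U p := by
    simpa only [add_zero] using hp.add (tendstoWeakly_of_tendsto (hv.mono_left hU))
  exact DeviationFBS.exists_isSolution_of_tendstoWeakly hmat hF hLc hB (hwb.mono hU)
    (hxb.mono hU) (hu.mono_left hU) (hx.mono_left hU) hmem hw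

end IsGenerated

end Convergence

end DeviationFBS

end

theorem mainTheorem1 {H : Type*} [NormedAddCommGroup H] [InnerProductSpace ℝ H] [CompleteSpace H]
    (n m : ℕ) (hn : 2 ≤ n)
    (F : Fin n → H → Set H) (hF : ∀ i, MaximallyMonotone (F i))
    (B : Fin m → H → H) (Lc : Fin m → ℝ) (hLc : ∀ j, 0 < Lc j)
    (hB : ∀ j, Cocoercive (1 / Lc j) (B j))
    (hzer : (zer (∑ i, F i + ∑ j, singleValued (B j))).Nonempty)
    (ε θ : ℝ) (γ ξ : ℕ → ℝ) (hpar : ParameterAssumption ε θ γ ξ)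
    (M : Matrix (Fin n) (Fin (n - 1)) ℝ) (S : Matrix (Fin n) (Fin n) ℝ)
    (C : Matrix (Fin n) (Fin m) ℝ) (Q : Matrix (Fin m) (Fin n) ℝ)
    (hmat : MatrixAssumption θ Lc M S C Q)
    (x : ℕ → HilbertPow H n) (z : ℕ → HilbertPow H (n - 1))
    (u : ℕ → HilbertPow H m) (v : ℕ → HilbertPow H (n - 1))
    (hgen : IsGenerated F B Lc M S C Q θ γ ξ x z u v)
    (γ₀ : ℝ) (hγ₀ : 0 < γ₀) :
    (Summable (lSq γ z v) ∧ Tendsto u atTop (𝓝 0) ∧ Tendsto v atTop (𝓝 0)) ∧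
    (∀ p ∈ fixedPts (opT F B M S C Q γ₀),
      ∃ l : ℝ, Tendsto (fun k => ‖z k - p‖) atTop (𝓝 l)) ∧
    (Tendsto (fun k => z (k + 1) - z k) atTop (𝓝 0) ∧
      ∀ s : Fin n → ℝ, ∑ i, s i = 0 →
        Tendsto (fun k => ∑ i, s i • x k i) atTop (𝓝 0)) ∧
    (∃ p ∈ fixedPts (opT F B M S C Q γ₀), WeaklyConverges z p) ∧
    (∃ a ∈ zer (∑ i, F i + ∑ j, singleValued (B j)),
      WeaklyConverges x (WithLp.toLp 2 fun _ => a)) := by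
  have : NeZero n := ⟨by omega⟩
  have hS := hmat.S_diag_pos hn hpar.theta_pos hLc
  have hfix : ∀ p, p ∈ fixedPts (opT F B M S C Q γ₀) ↔ ∃ a, IsSolution F B M S C p a :=
    fun _ => mem_fixedPts_opT_iff hmat (fun i => (hS i).ne') hγ₀.ne'
  have hdescent {p a} (hp : IsSolution F B M S C p a) :=
    hgen.summable_lSq_and_tendsto hmat hpar (fun i => (hS i).ne') hF hLc hB hp
  obtain ⟨a₀, ha₀⟩ := hzer
  obtain ⟨p₀, hp₀⟩ := exists_isSolution_of_mem_zer hmat ha₀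
  obtain ⟨hl, hdev, r, hr⟩ := hdescent hp₀
  have hu := hpar.tendsto_u hLc hdev
  have hv := hpar.tendsto_v hLc hdev
  have hz := hpar.tendsto_z_succ_sub hl hv
  have hMx := hgen.tendsto_kron_transpose hpar hz
  have hdist (p) (hp : p ∈ fixedPts (opT F B M S C Q γ₀)) :=
    ((hfix p).mp hp).elim fun _ ha => (hdescent ha).2.2
  have hcluster (U : Ultrafilter ℕ) (p : HilbertPow H (n - 1)) (hU : (U : Filter ℕ) ≤ atTop) :=
    hgen.exists_isSolution_of_tendstoWeakly hmat hS hF hLc hB hp₀ hr hu hv hMx hU (p := p)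
  obtain ⟨p, hp, hzp⟩ := exists_mem_tendstoWeakly_of_tendsto_norm_sub ⟨p₀, (hfix p₀).mpr ⟨a₀, hp₀⟩⟩
    hdist fun U p hU hpU => (hfix p).mpr ((hcluster U p hU hpU).imp fun _ => And.left)
  obtain ⟨a, ha⟩ := (hfix p).mp hp
  refine ⟨⟨hl, hu, hv⟩, hdist, ⟨hz, fun s hs => tendsto_sum_smul_of_tendsto_kron_transpose
    hmat.ker_le hs hMx⟩, ⟨p, hp, hzp⟩, a, ha.mem_zer hmat, tendsto_iff_ultrafilter _ _ _ |>.mpr ?_⟩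
  intro U hU
  obtain ⟨a', ha', hx⟩ := hcluster U p hU (hzp.mono hU)
  exact ha.unique hmat.causal (hS 0) (hF 0) ha' ▸ hx
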